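/- Let $f:\{1,2,3,\dots\}\to\mathbb C$ be completely multiplicative, that is, $f(ab)=f(a)f(b)$ for all integers $a,b\ge 1$, and suppose that $|f(p)|\le 1$ for every prime $p$. A function $g:\{1,2,3,\dots\}\to\mathbb C$ is called CMO if it is not identically zero, satisfies $g(ab)=g(a)g(b)$ for all $a,b\ge1$, and $\sum_{n=1}^{\infty} g(n)=0$ in the sense that the partial sums $\sum_{n=1}^{N} g(n)$ converge to $0$ as $N\to\infty$. Sums over $p$ run over the primes. (1) If $$\limsup_{x\to+\infty}\ \frac{\sum_{p\le x}|1+f(p)|^2}{x/\log x}<1,$$ then the function $n\mapsto f(n)/n$ is CMO. (2) More generally, if $$\int_1^2 \exp\Big\{\frac12\sum_p\frac{|1+f(p)|^2}{p^{\sigma}}\Big\}\,\frac{d\sigma}{\sqrt{\sigma-1}}<+\infty,$$ then the function $n\mapsto f(n)/n$ is CMO. -/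

import Mathlib

/-- Complete multiplicativity of an arithmetic function, viewed as a function on the positive
integers (the value `f 0` plays no role). The zero function is allowed. -/
def IsCM (f : ℕ → ℂ) : Prop :=
  ∀ a b : ℕ, 1 ≤ a → 1 ≤ b → f (a * b) = f a * f b

/-- CMO functions: completely multiplicative functions on the positive integers, not identically
zero, whose partial sums `∑_{n=1}^N f n` converge to `0`. -/
structure IsCMO (f : ℕ → ℂ) : Prop where
  not_identically_zero : ∃ n : ℕ, 1 ≤ n ∧ f n ≠ 0
  completely_multiplicative : IsCM f
  sum_eq_zero :
    Filter.Tendsto (fun N : ℕ => ∑ n ∈ Finset.Icc 1 N, f n) Filter.atTop (nhds 0)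

/-!
Both hypotheses say that `f` is close to the Liouville function on the primes, and they enter the
argument only through one consequence. Put `w(p) = |1 + f(p)|` and
`D(a) = ∑_p w(p)² p^(-1-a)` (`primeWeightSum`). Then `a * exp (D a) → 0` as `a → 0⁺`: under the
integral condition because `D` is antitone, so that the integral over `(1, 1 + a]` dominates
`√a * exp (D a / 2)`; under the `limsup` condition because partial summation gives
`D(a) ≤ δ log (1/a) + C` with some `δ < 1`.

Write `f = μ * (f * 1)` for Dirichlet convolution, so that, with `m(u) = ∑_{n ≤ u} μ(n)/n`,
`∑_{n ≤ x} f(n)/n = ∑_d (f * 1)(d)/d * m(x/d)`. Three facts make this tend to `0`.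

* The function `m` is integrable for `du/u` on `[1, ∞)` (`integrable_moebiusMean_exp`). On the
  line `Re s = a`, the derivative of `1/(s ζ(1+s))` is, up to sign and scaling, the Fourier
  transform of `v m(e^v) e^(-av)`. The bounds `ζ, ζ' ≪ (log |t|)^O(1)` together with the lower
  bound for `ζ` that follows from the `3-4-1` inequality majorize that derivative by a fixed square
  integrable function, uniformly in `a`. By Plancherel `v m(e^v)` is square integrable, and
  `|m| ≤ (v |m|)² + v⁻²` gives the integrability of `m(e^v)`.
* Pairing consecutive powers of `f(p)` shows `|f * 1| ≤ □ * G`, where `□` is the indicator of the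
  squares and `G(n) = ∏_{p ∣ n} w(p)` (`norm_positivePart_mul_zeta_le`).
* The logarithmic mass of `G` on `(y, 2y]` tends to `0` (`tendsto_dyadicSum_prodPrimeFactors`).
  Rankin's trick at `σ = 1 + 1/log N`, with `2 w(p) ≤ 1 + w(p)²`, gives
  `∑_{n ≤ N} G(n)/n = o(log N)`, and Chebyshev's estimate with the identity `log = Λ * 1` gains
  the factor `log N` on a dyadic block. Convolving with `□`, for which `∑ □(n)/n < ∞`,
  preserves this.

Integrating over `x ∈ [e^v, 2e^v]` with respect to `dx/x`, every `m(x/d)` meets only a dyadic block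
of values of `d`, and dominated convergence shows that the partial sums tend to `0` in mean over
such windows (`tendsto_setIntegral_norm`). As `|f(n)/n| ≤ 1/n`, the partial sums vary slowly on the
logarithmic scale, so that they tend to `0` themselves (`tendsto_sum_of_tendsto_setIntegral`).
-/

/-! ### Comparing a sum with an integral -/

section

/-- One term of a sum against the integral of `F` over a unit interval, where `G` is a
primitive of `F`. -/
lemma norm_apply_add_one_sub_le {F F' G : ℝ → ℂ} {a B : ℝ}
    (hG : ∀ x ∈ Set.Icc a (a + 1), HasDerivAt G (F x) x)
    (hF : ∀ x ∈ Set.Icc a (a + 1), HasDerivAt F (F' x) x)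
    (hB : ∀ x ∈ Set.Icc a (a + 1), ‖F' x‖ ≤ B) :
    ‖F (a + 1) - (G (a + 1) - G a)‖ ≤ B := by
  have hr : a + 1 ∈ Set.Icc a (a + 1) := ⟨by linarith, le_rfl⟩
  have hl : a ∈ Set.Icc a (a + 1) := ⟨le_rfl, by linarith⟩
  have hB0 : 0 ≤ B := (norm_nonneg _).trans (hB a hl)
  have h1 : ∀ x ∈ Set.Icc a (a + 1), ‖F x - F (a + 1)‖ ≤ B := by
    intro x hx
    have := (convex_Icc a (a + 1)).norm_image_sub_le_of_norm_hasDerivWithin_le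
      (fun y hy => (hF y hy).hasDerivWithinAt) hB hr hx
    refine this.trans ?_
    have : ‖x - (a + 1)‖ ≤ 1 := by
      rw [Real.norm_eq_abs, abs_le]; constructor <;> linarith [hx.1, hx.2]
    nlinarith
  have h2 := (convex_Icc a (a + 1)).norm_image_sub_le_of_norm_hasDerivWithin_le
    (f := fun x : ℝ => G x - (x : ℂ) * F (a + 1)) (f' := fun x => F x - F (a + 1))
    (fun y hy => by
      have := (hG y hy).sub ((Complex.ofRealCLM.hasDerivAt (x := y)).mul_const (F (a + 1)))
      simp only [Complex.ofRealCLM_apply, Complex.ofReal_one, one_mul] at this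
      exact this.hasDerivWithinAt) h1 hl hr
  have h3 : ‖a + 1 - a‖ = (1 : ℝ) := by simp
  rw [h3, mul_one] at h2
  convert h2 using 1
  rw [← norm_neg]
  congr 1
  push_cast
  ring

/-- The series `∑ x^(-3/2)` is dominated by a telescoping one. -/
lemma inv_mul_sqrt_le_telescope {x : ℝ} (hx : 1 ≤ x) :
    1 / (x * √x) ≤ 4 * (1 / √x - 1 / √(x + 1)) := by
  have hx0 : 0 < x := by linarith
  set u := √x with hu
  set w := √(x + 1) with hw
  have hu1 : 1 ≤ u := by rw [hu]; exact Real.one_le_sqrt.mpr hx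
  have hu2 : u ^ 2 = x := Real.sq_sqrt hx0.le
  have hw2 : w ^ 2 = x + 1 := Real.sq_sqrt (by linarith)
  have hw0 : 0 < w := Real.sqrt_pos.mpr (by linarith)
  have hwu : w ≤ 3 / 2 * u := by
    apply le_of_sq_le_sq _ (by positivity)
    nlinarith
  have huw : u ≤ w := Real.sqrt_le_sqrt (by linarith)
  have key : 1 / u - 1 / w = 1 / (u * w * (u + w)) := by
    field_simp
    nlinarith
  rw [key, ← hu2]
  have h4 : u * w * (u + w) ≤ 4 * u ^ 3 := by
    have : w * (u + w) ≤ (3 / 2 * u) * (u + 3 / 2 * u) := by gcongr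
    nlinarith
  rw [mul_one_div, div_le_div_iff₀ (by positivity) (by positivity)]
  linarith

/-- A convergent series `∑ F(n)` whose function has a primitive `G` vanishing at infinity: the tail
beyond `N` is `-G(N)`, with an error of order `A / √N` if `F'` is at most `A x^(-3/2)`. -/
lemma norm_hasSum_sub_sum_add_le {F F' G : ℝ → ℂ} {A : ℝ} {z : ℂ}
    (hG : ∀ x, 1 ≤ x → HasDerivAt G (F x) x)
    (hF : ∀ x, 1 ≤ x → HasDerivAt F (F' x) x)
    (hA : ∀ x, 1 ≤ x → ‖F' x‖ ≤ A / (x * √x))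
    (hG0 : Filter.Tendsto G Filter.atTop (nhds 0))
    (hz : HasSum (fun n : ℕ => F ((n : ℝ) + 1)) z) {N : ℕ} (hN : 1 ≤ N) :
    ‖z - ∑ n ∈ Finset.range N, F ((n : ℝ) + 1) + G N‖ ≤ 4 * A / √N := by
  have hA0 : 0 ≤ A := by
    have := (norm_nonneg _).trans (hA 1 le_rfl)
    simpa using this
  have step : ∀ n : ℕ, 1 ≤ n → ‖F ((n : ℝ) + 1) - (G ((n : ℝ) + 1) - G n)‖
      ≤ A * (4 * (1 / √(n : ℝ) - 1 / √((n : ℝ) + 1))) := by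
    intro n hn
    have hn1 : (1 : ℝ) ≤ n := by exact_mod_cast hn
    refine (norm_apply_add_one_sub_le (B := A / (n * √n)) (fun x hx => hG x (hn1.trans hx.1))
      (fun x hx => hF x (hn1.trans hx.1)) (fun x hx => ?_)).trans ?_
    · refine (hA x (hn1.trans hx.1)).trans ?_
      have := hx.1
      have : 0 ≤ x := by linarith
      gcongr
    · rw [div_eq_mul_one_div]
      exact mul_le_mul_of_nonneg_left (inv_mul_sqrt_le_telescope hn1) hA0
  have bound : ∀ M : ℕ, N ≤ M → ‖∑ n ∈ Finset.range M, F ((n : ℝ) + 1)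
      - ∑ n ∈ Finset.range N, F ((n : ℝ) + 1) - (G M - G N)‖
        ≤ A * (4 * (1 / √(N : ℝ) - 1 / √(M : ℝ))) := by
    intro M hM
    induction M, hM using Nat.le_induction with
    | base => simp
    | succ M hM ih =>
      rw [Finset.sum_range_succ]
      have h1 := step M (hN.trans hM)
      push_cast
      calc _ = ‖(∑ n ∈ Finset.range M, F ((n : ℝ) + 1)
          - ∑ n ∈ Finset.range N, F ((n : ℝ) + 1) - (G M - G N)) +
          (F ((M : ℝ) + 1) - (G ((M : ℝ) + 1) - G M))‖ := by congr 1; ring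
        _ ≤ _ := (norm_add_le _ _).trans (add_le_add ih h1)
        _ = _ := by ring
  have lim : Filter.Tendsto (fun M : ℕ => ‖∑ n ∈ Finset.range M, F ((n : ℝ) + 1)
      - ∑ n ∈ Finset.range N, F ((n : ℝ) + 1) - (G M - G N)‖) Filter.atTop
      (nhds ‖z - ∑ n ∈ Finset.range N, F ((n : ℝ) + 1) - (0 - G N)‖) :=
    (((hz.tendsto_sum_nat.sub_const _)).sub
      ((hG0.comp tendsto_natCast_atTop_atTop).sub_const _)).norm
  have := le_of_tendsto lim (b := 4 * A / √(N : ℝ)) (by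
    filter_upwards [Filter.eventually_ge_atTop N] with M hM
    refine (bound M hM).trans ?_
    have : 0 ≤ 1 / √(M : ℝ) := by positivity
    calc _ ≤ A * (4 * (1 / √(N : ℝ) - 0)) := by gcongr
      _ = _ := by ring)
  simpa [sub_eq_add_neg] using this

end

/-! ### Approximating the zeta function and its derivative by partial sums -/

section

open Complex

lemma norm_natCast_cpow_neg_le {s : ℂ} (hs : 1 < s.re) (n : ℕ) :
    ‖(((n : ℝ) + 1 : ℝ) : ℂ) ^ (-s)‖ ≤ ((n : ℝ) + 1)⁻¹ := by
  rw [norm_cpow_eq_rpow_re_of_pos (by positivity), neg_re, ← Real.rpow_neg_one]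
  exact Real.rpow_le_rpow_of_exponent_le (by linarith [(Nat.cast_nonneg n : (0 : ℝ) ≤ n)])
    (by linarith)

lemma sum_range_inv_le (N : ℕ) :
    ∑ n ∈ Finset.range N, ((n : ℝ) + 1)⁻¹ ≤ 1 + Real.log N := by
  have := harmonic_le_one_add_log N
  simpa [harmonic] using this

lemma norm_cpow_neg_sub_one_le {s : ℂ} (hs : 1 < s.re) {x : ℝ} (hx : 1 ≤ x) :
    ‖(x : ℂ) ^ (-s - 1)‖ ≤ 1 / x ^ 2 := by
  rw [norm_cpow_eq_rpow_re_of_pos (by linarith)]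
  calc x ^ (-s - 1).re ≤ x ^ (-2 : ℝ) :=
        Real.rpow_le_rpow_of_exponent_le hx (by simp; linarith)
    _ = 1 / x ^ 2 := by
        rw [Real.rpow_neg (by linarith), one_div]; norm_cast

lemma tendsto_ofReal_cpow_mul_atTop {s : ℂ} (hs : 1 < s.re) (a b : ℂ) :
    Filter.Tendsto (fun x : ℝ => (x : ℂ) ^ (1 - s) * (a * Real.log x + b)) Filter.atTop
      (nhds 0) := by
  have hr : 0 < s.re - 1 := by linarith
  have h1 : Filter.Tendsto (fun x : ℝ => x ^ (-(s.re - 1))) Filter.atTop (nhds 0) :=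
    tendsto_rpow_neg_atTop hr
  have h2 : Filter.Tendsto (fun x : ℝ => Real.log x / x ^ (s.re - 1)) Filter.atTop (nhds 0) :=
    (isLittleO_log_rpow_atTop hr).tendsto_div_nhds_zero
  have h3 := (h2.const_mul ‖a‖).add (h1.mul_const ‖b‖)
  simp only [mul_zero, zero_mul, add_zero] at h3
  refine squeeze_zero_norm' ?_ h3
  filter_upwards [Filter.eventually_ge_atTop 1] with x hx
  have hx0 : 0 < x := by linarith
  rw [norm_mul, norm_cpow_eq_rpow_re_of_pos hx0]
  have e : (1 - s).re = -(s.re - 1) := by simp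
  rw [e]
  calc _ ≤ x ^ (-(s.re - 1)) * (‖a‖ * Real.log x + ‖b‖) := by
        gcongr
        refine (norm_add_le _ _).trans ?_
        rw [norm_mul, norm_real, Real.norm_of_nonneg (Real.log_nonneg hx)]
    _ = _ := by rw [Real.rpow_neg hx0.le]; ring

lemma hasDerivAt_cpow_neg {s : ℂ} (hs : 1 < s.re) {x : ℝ} (hx : 1 ≤ x) :
    HasDerivAt (fun y : ℝ => (y : ℂ) ^ (-s)) (-s * (x : ℂ) ^ (-s - 1)) x := by
  refine hasDerivAt_ofReal_cpow_const (x := x) (by linarith) (r := -s) ?_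
  intro h
  have := congrArg re h
  simp at this
  linarith

lemma hasDerivAt_cpow_one_sub {s : ℂ} (hs : 1 < s.re) {x : ℝ} (hx : 1 ≤ x) :
    HasDerivAt (fun y : ℝ => (y : ℂ) ^ (1 - s)) ((1 - s) * (x : ℂ) ^ (-s)) x := by
  have := hasDerivAt_ofReal_cpow_const (x := x) (by linarith) (r := 1 - s) (by
    intro h
    have := congrArg re h
    simp at this
    linarith)
  simpa using this

lemma hasDerivAt_ofReal_log {x : ℝ} (hx : 1 ≤ x) :
    HasDerivAt (fun y : ℝ => (Real.log y : ℂ)) ((x : ℂ)⁻¹) x := by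
  have := (Real.hasDerivAt_log (x := x) (by linarith)).ofReal_comp
  simpa using this

lemma one_div_sq_le {x : ℝ} (hx : 1 ≤ x) : 1 / x ^ 2 ≤ 1 / (x * √x) := by
  have h : √x ≤ x := by
    rw [Real.sqrt_le_left (by linarith)]; nlinarith
  have : 0 < √x := Real.sqrt_pos.mpr (by linarith)
  rw [pow_two]
  gcongr

/-- Truncating `ζ(s)` at `N` costs `‖s‖ / √N` once the main term `N^(1-s) / (s-1)` is included. -/
lemma norm_zeta_sub_le {s : ℂ} (hs : 1 < s.re) {N : ℕ} (hN : 1 ≤ N) :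
    ‖riemannZeta s - ∑ n ∈ Finset.range N, (((n : ℝ) + 1 : ℝ) : ℂ) ^ (-s)
      + ((N : ℝ) : ℂ) ^ (1 - s) / (1 - s)‖ ≤ 4 * ‖s‖ / √N := by
  have h1s : (1 - s) ≠ 0 := by
    intro h
    have := congrArg re h
    simp at this
    linarith
  refine norm_hasSum_sub_sum_add_le (F := fun x => (x : ℂ) ^ (-s))
    (F' := fun x => -s * (x : ℂ) ^ (-s - 1)) (G := fun x => (x : ℂ) ^ (1 - s) / (1 - s))
    (A := ‖s‖) (fun x hx => ?_) (fun x hx => hasDerivAt_cpow_neg hs hx) (fun x hx => ?_) ?_ ?_ hN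
  · have := (hasDerivAt_cpow_one_sub hs hx).div_const (1 - s)
    rwa [mul_div_cancel_left₀ _ h1s] at this
  · rw [norm_mul, norm_neg, div_eq_mul_one_div]
    gcongr
    exact (norm_cpow_neg_sub_one_le hs hx).trans (one_div_sq_le hx)
  · simpa [div_eq_mul_inv] using tendsto_ofReal_cpow_mul_atTop hs 0 (1 - s)⁻¹
  · have := (hasSum_nat_add_iff (f := fun n : ℕ => LSeries.term 1 s n) 1).mpr
      (by simpa using! LSeriesHasSum_one hs)
    refine Eq.mp (congrArg (HasSum · _) (funext fun n => ?_)) this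
    rw [LSeries.term_def]
    simp [cpow_neg]

/-- Truncating `-ζ'(s) = ∑ log n / n^s` at `N`, with the primitive of `x ↦ log x / x^s`
as main term. -/
lemma norm_deriv_zeta_sub_le {s : ℂ} (hs : 1 < s.re) {N : ℕ} (hN : 1 ≤ N) :
    ‖-deriv riemannZeta s -
      ∑ n ∈ Finset.range N, (Real.log ((n : ℝ) + 1) : ℂ) * (((n : ℝ) + 1 : ℝ) : ℂ) ^ (-s)
      + ((N : ℝ) : ℂ) ^ (1 - s) * ((1 - s)⁻¹ * Real.log N + -((1 - s)⁻¹) ^ 2)‖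
      ≤ 4 * (1 + 2 * ‖s‖) / √N := by
  have h1s : (1 - s) ≠ 0 := by
    intro h
    have := congrArg re h
    simp at this
    linarith
  refine norm_hasSum_sub_sum_add_le (F := fun x => (Real.log x : ℂ) * (x : ℂ) ^ (-s))
    (F' := fun x => (x : ℂ)⁻¹ * (x : ℂ) ^ (-s) + Real.log x * (-s * (x : ℂ) ^ (-s - 1)))
    (G := fun x => (x : ℂ) ^ (1 - s) * ((1 - s)⁻¹ * Real.log x + -((1 - s)⁻¹) ^ 2))
    (A := 1 + 2 * ‖s‖) (fun x hx => ?_)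
    (fun x hx => (hasDerivAt_ofReal_log hx).mul (hasDerivAt_cpow_neg hs hx)) (fun x hx => ?_)
    (tendsto_ofReal_cpow_mul_atTop hs _ _) ?_ hN
  · have hx0 : (x : ℂ) ≠ 0 := by exact_mod_cast (by linarith : x ≠ 0)
    have := (hasDerivAt_cpow_one_sub hs hx).mul
      (((hasDerivAt_ofReal_log hx).const_mul (1 - s)⁻¹).add_const (-((1 - s)⁻¹) ^ 2))
    refine this.congr_deriv ?_
    rw [show (1 - s : ℂ) = -s + 1 by ring, cpow_add _ _ hx0, cpow_one]
    rw [show (1 - s : ℂ) = -s + 1 by ring] at h1s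
    field_simp
    ring
  · have hx0 : (x : ℂ) ≠ 0 := by exact_mod_cast (by linarith : x ≠ 0)
    have e : (x : ℂ)⁻¹ * (x : ℂ) ^ (-s) = (x : ℂ) ^ (-s - 1) := by
      rw [cpow_sub _ _ hx0, cpow_one]; field_simp
    have hb := norm_cpow_neg_sub_one_le hs hx
    have hsq : 1 ≤ √x := Real.one_le_sqrt.mpr hx
    have hxs : √x * √x = x := Real.mul_self_sqrt (by linarith)
    have hlog : Real.log x ≤ 2 * √x := by
      have h1 := Real.log_le_sub_one_of_pos (x := √x) (by linarith)
      rw [Real.log_sqrt (by linarith)] at h1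
      linarith
    rw [e]
    calc _ ≤ ‖(x : ℂ) ^ (-s - 1)‖ + Real.log x * (‖s‖ * ‖(x : ℂ) ^ (-s - 1)‖) := by
          refine (norm_add_le _ _).trans ?_
          rw [norm_mul, norm_mul, norm_neg, norm_real, Real.norm_of_nonneg (Real.log_nonneg hx)]
      _ ≤ 1 / x ^ 2 + (2 * √x) * (‖s‖ * (1 / x ^ 2)) := by gcongr
      _ = (1 + 2 * √x * ‖s‖) * (1 / x ^ 2) := by ring
      _ ≤ ((1 + 2 * ‖s‖) * √x) * (1 / x ^ 2) := by
          gcongr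
          nlinarith [norm_nonneg s]
      _ = _ := by
          have h2 : √x * (1 / x ^ 2) = 1 / (x * √x) := by
            have : 0 < √x := by linarith
            rw [mul_one_div, div_eq_div_iff (by positivity) (by positivity),
              show √x * (x * √x) = x * (√x * √x) by ring, hxs]
            ring
          rw [mul_assoc, h2, mul_one_div]
  · have hs' : LSeries.abscissaOfAbsConv 1 < s.re := by
      rw [LSeries.abscissaOfAbsConv_one]; exact_mod_cast hs
    have hd : deriv riemannZeta s = - LSeries (LSeries.logMul 1) s := by
      rw [← LSeries_deriv hs']
      apply Filter.EventuallyEq.deriv_eq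
      have : {z : ℂ | 1 < z.re} ∈ nhds s := (isOpen_lt continuous_const continuous_re).mem_nhds hs
      filter_upwards [this] with z hz
      exact (LSeries_one_eq_riemannZeta hz).symm
    have hsum := (LSeriesSummable_logMul_of_lt_re hs').LSeriesHasSum
    rw [hd, neg_neg]
    have := (hasSum_nat_add_iff (f := fun n : ℕ => LSeries.term (LSeries.logMul 1) s n) 1).mpr
      (by simpa using! hsum)
    refine Eq.mp (congrArg (HasSum · _) (funext fun n => ?_)) this
    rw [LSeries.term_def]
    simp [cpow_neg, LSeries.logMul, div_eq_mul_inv]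
    left
    have : ((n : ℂ) + 1) = (((n : ℝ) + 1 : ℝ) : ℂ) := by push_cast; rfl
    rw [this, Complex.ofReal_log (by positivity)]

end

/-! ### Upper bounds for the zeta function near the line `Re s = 1` -/

section

open Complex

/-- The scale `2 + 2 log |t|` in which the growth of `ζ` at height `t` is measured. -/
noncomputable def logScale (t : ℝ) : ℝ := 2 + 2 * Real.log |t|

lemma two_le_logScale {t : ℝ} (ht : 1 ≤ |t|) : 2 ≤ logScale t := by
  unfold logScale
  linarith [Real.log_nonneg ht]

/-- The truncation point `N ≈ t²` makes the error term `|t| / √N` bounded, while `log N` stays of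
order `log |t|`. -/
lemma exists_nat_sq_le {t : ℝ} (ht : 1 ≤ |t|) :
    ∃ N : ℕ, 1 ≤ N ∧ |t| ≤ √N ∧ 1 + Real.log N ≤ logScale t := by
  refine ⟨⌈|t| ^ 2⌉₊, ?_, ?_, ?_⟩
  · exact Nat.one_le_ceil_iff.mpr (by positivity)
  · exact Real.le_sqrt_of_sq_le (Nat.le_ceil _)
  · have h1 : (⌈|t| ^ 2⌉₊ : ℝ) ≤ 2 * |t| ^ 2 := by
      have := (Nat.ceil_lt_add_one (a := |t| ^ 2) (by positivity)).le
      nlinarith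
    have h2 : (0 : ℝ) < ⌈|t| ^ 2⌉₊ := by
      have : 0 < ⌈|t| ^ 2⌉₊ := Nat.ceil_pos.mpr (by positivity)
      exact_mod_cast this
    have h3 := Real.log_le_log h2 h1
    rw [Real.log_mul (by norm_num) (by positivity), Real.log_pow] at h3
    have := Real.log_two_lt_d9
    unfold logScale
    push_cast at h3
    linarith

section
variable {s : ℂ}

lemma norm_le_three_mul_abs_im (h1 : 1 < s.re) (h2 : s.re ≤ 2) (ht : 1 ≤ |s.im|) :
    ‖s‖ ≤ 3 * |s.im| := by
  have := norm_le_abs_re_add_abs_im s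
  rw [abs_of_pos (by linarith : 0 < s.re)] at this
  linarith

lemma norm_inv_one_sub_le (ht : 1 ≤ |s.im|) : ‖(1 - s)⁻¹‖ ≤ 1 := by
  rw [norm_inv]
  apply inv_le_one_of_one_le₀
  have := abs_im_le_norm (1 - s)
  simp at this
  linarith

lemma norm_natCast_cpow_one_sub_le (h1 : 1 < s.re) {N : ℕ} (hN : 1 ≤ N) :
    ‖((N : ℝ) : ℂ) ^ (1 - s)‖ ≤ 1 := by
  have hN1 : (1 : ℝ) ≤ N := by exact_mod_cast hN
  rw [norm_cpow_eq_rpow_re_of_pos (by linarith)]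
  exact Real.rpow_le_one_of_one_le_of_nonpos hN1 (by simp; linarith)

lemma norm_zeta_le (h1 : 1 < s.re) (h2 : s.re ≤ 2) (ht : 1 ≤ |s.im|) :
    ‖riemannZeta s‖ ≤ 8 * logScale s.im := by
  obtain ⟨N, hN, hsq, hL⟩ := exists_nat_sq_le ht
  have hL2 := two_le_logScale ht
  have hA := norm_zeta_sub_le h1 hN
  have hB : 4 * ‖s‖ / √N ≤ 12 := by
    rw [div_le_iff₀ (by linarith)]
    linarith [norm_le_three_mul_abs_im h1 h2 ht]
  have hC : ‖∑ n ∈ Finset.range N, (((n : ℝ) + 1 : ℝ) : ℂ) ^ (-s)‖ ≤ logScale s.im :=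
    (norm_sum_le_of_le _ fun n _ => norm_natCast_cpow_neg_le h1 n).trans
      ((sum_range_inv_le N).trans hL)
  have hD : ‖((N : ℝ) : ℂ) ^ (1 - s) / (1 - s)‖ ≤ 1 := by
    rw [div_eq_mul_inv, norm_mul]
    exact mul_le_one₀ (norm_natCast_cpow_one_sub_le h1 hN) (norm_nonneg _) (norm_inv_one_sub_le ht)
  set S := ∑ n ∈ Finset.range N, (((n : ℝ) + 1 : ℝ) : ℂ) ^ (-s)
  set g := ((N : ℝ) : ℂ) ^ (1 - s) / (1 - s)
  calc ‖riemannZeta s‖ = ‖(riemannZeta s - S + g) + (S - g)‖ := by congr 1; ring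
    _ ≤ 12 + (logScale s.im + 1) := (norm_add_le _ _).trans (add_le_add (hA.trans hB)
        ((norm_sub_le _ _).trans (add_le_add hC hD)))
    _ ≤ _ := by linarith

lemma norm_deriv_zeta_le (h1 : 1 < s.re) (h2 : s.re ≤ 2) (ht : 1 ≤ |s.im|) :
    ‖deriv riemannZeta s‖ ≤ 10 * logScale s.im ^ 2 := by
  obtain ⟨N, hN, hsq, hL⟩ := exists_nat_sq_le ht
  have hN1 : (1 : ℝ) ≤ N := by exact_mod_cast hN
  have hlN : 0 ≤ Real.log N := Real.log_nonneg hN1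
  have hL2 := two_le_logScale ht
  have hA := norm_deriv_zeta_sub_le h1 hN
  have hB : 4 * (1 + 2 * ‖s‖) / √N ≤ 28 := by
    rw [div_le_iff₀ (by linarith)]
    linarith [norm_le_three_mul_abs_im h1 h2 ht]
  have hC : ‖∑ n ∈ Finset.range N, (Real.log ((n : ℝ) + 1) : ℂ) * (((n : ℝ) + 1 : ℝ) : ℂ) ^ (-s)‖
      ≤ logScale s.im ^ 2 := by
    calc _ ≤ ∑ n ∈ Finset.range N, Real.log N * ((n : ℝ) + 1)⁻¹ := by
          refine norm_sum_le_of_le _ fun n hn => ?_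
          have hn' : (n : ℝ) + 1 ≤ N := by exact_mod_cast Finset.mem_range.mp hn
          have hn0 : (0 : ℝ) ≤ n := Nat.cast_nonneg n
          rw [norm_mul, norm_real, Real.norm_of_nonneg (Real.log_nonneg (by linarith))]
          have := norm_natCast_cpow_neg_le h1 n
          gcongr
      _ ≤ Real.log N * (1 + Real.log N) := by
          rw [← Finset.mul_sum]
          have := sum_range_inv_le N
          gcongr
      _ ≤ _ := by nlinarith
  have hi := norm_inv_one_sub_le ht
  have hD : ‖((N : ℝ) : ℂ) ^ (1 - s) * ((1 - s)⁻¹ * Real.log N + -((1 - s)⁻¹) ^ 2)‖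
      ≤ logScale s.im := by
    rw [norm_mul]
    calc _ ≤ 1 * (1 * Real.log N + 1 ^ 2) := by
          gcongr
          · exact norm_natCast_cpow_one_sub_le h1 hN
          · refine (norm_add_le _ _).trans ?_
            rw [norm_mul, norm_real, Real.norm_of_nonneg hlN, norm_neg, norm_pow]
            gcongr
      _ ≤ _ := by linarith
  set S := ∑ n ∈ Finset.range N, (Real.log ((n : ℝ) + 1) : ℂ) * (((n : ℝ) + 1 : ℝ) : ℂ) ^ (-s)
  set g := ((N : ℝ) : ℂ) ^ (1 - s) * ((1 - s)⁻¹ * Real.log N + -((1 - s)⁻¹) ^ 2)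
  calc ‖deriv riemannZeta s‖ = ‖(-deriv riemannZeta s - S + g) + (S - g)‖ := by
        rw [← norm_neg]; congr 1; ring
    _ ≤ 28 + (logScale s.im ^ 2 + logScale s.im) :=
        (norm_add_le _ _).trans (add_le_add (hA.trans hB)
          ((norm_sub_le _ _).trans (add_le_add hC hD)))
    _ ≤ _ := by nlinarith

end

/-- The simple pole of `ζ` at `1`, as an upper bound. -/
lemma norm_zeta_one_add_le {x : ℝ} (hx : 0 < x) (hx1 : x ≤ 1) :
    ‖riemannZeta (1 + x)‖ ≤ 10 / x := by
  have h := norm_zeta_sub_le (s := 1 + x) (N := 1) (by simp; linarith) le_rfl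
  have e : ‖(1 + x : ℂ)‖ = 1 + x := by
    have : (1 + x : ℂ) = ((1 + x : ℝ) : ℂ) := by push_cast; rfl
    rw [this, norm_real, Real.norm_of_nonneg (by linarith)]
  rw [e] at h
  have h2 : riemannZeta (1 + x) = (riemannZeta (1 + x) - 1 - (x : ℂ)⁻¹) + (1 + (x : ℂ)⁻¹) := by ring
  have h3 : ‖(1 + (x : ℂ)⁻¹)‖ ≤ 1 + x⁻¹ := by
    refine (norm_add_le _ _).trans ?_
    rw [norm_inv, norm_real, Real.norm_of_nonneg hx.le, norm_one]
  have h4 : ‖riemannZeta (1 + x) - 1 - (x : ℂ)⁻¹‖ ≤ 4 * (1 + x) := by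
    simpa [neg_div, div_eq_mul_inv, sub_eq_add_neg, inv_neg] using h
  rw [h2]
  refine ((norm_add_le _ _).trans (add_le_add h4 h3)).trans ?_
  rw [div_eq_mul_inv]
  have h5 : 1 ≤ x⁻¹ := (one_le_inv₀ hx).mpr hx1
  have : x ≤ x⁻¹ := by linarith
  linarith

/-- The `3-4-1` inequality. -/
lemma one_le_norm_zeta_product {x : ℝ} (hx : 0 < x) (t : ℝ) :
    1 ≤ ‖riemannZeta (1 + x)‖ ^ 3 * ‖riemannZeta (1 + x + I * t)‖ ^ 4 *
      ‖riemannZeta (1 + x + 2 * I * t)‖ := by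
  have := DirichletCharacter.norm_LFunction_product_ge_one (N := 1) 1 hx t
  simpa [DirichletCharacter.LFunctionTrivChar, DirichletCharacter.LFunction_modOne_eq] using this

end

/-! ### Lower bounds for the zeta function near the line `Re s = 1` -/

section

open Complex

lemma logScale_two_mul_le {t : ℝ} (ht : 1 ≤ |t|) : logScale (2 * t) ≤ 2 * logScale t := by
  unfold logScale
  rw [abs_mul, Real.log_mul (by norm_num) (by linarith)]
  have := Real.log_two_lt_d9
  have := Real.log_nonneg ht
  simp only [abs_two]
  linarith

/-- The lower bound for `ζ` that the `3-4-1` inequality gives; it degenerates as `x → 0`. -/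
lemma pow_four_norm_zeta_ge {x t : ℝ} (hx : 0 < x) (hx1 : x ≤ 1) (ht : 1 ≤ |t|) :
    x ^ 3 / (16000 * logScale t) ≤ ‖riemannZeta (1 + x + I * t)‖ ^ 4 := by
  have hL := two_le_logScale ht
  have h := one_le_norm_zeta_product hx t
  have h1 := norm_zeta_one_add_le hx hx1
  have h2 : ‖riemannZeta (1 + x + 2 * I * t)‖ ≤ 16 * logScale t := by
    have := norm_zeta_le (s := 1 + x + 2 * I * t) (by simp; linarith) (by simp; linarith)
      (by simp [abs_mul]; linarith)
    have h3 := logScale_two_mul_le ht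
    simp at this
    linarith
  have h3 : 1 ≤ (10 / x) ^ 3 * ‖riemannZeta (1 + x + I * t)‖ ^ 4 * (16 * logScale t) := by
    refine h.trans ?_
    gcongr
  rw [div_le_iff₀ (by positivity)]
  have h4 := mul_le_mul_of_nonneg_left h3 (by positivity : 0 ≤ x ^ 3)
  have h5 : x ^ 3 * ((10 / x) ^ 3 * ‖riemannZeta (1 + x + I * t)‖ ^ 4 * (16 * logScale t))
    = ‖riemannZeta (1 + x + I * t)‖ ^ 4 * (16000 * logScale t) := by
    field_simp
    ring
  linarith

/-- A lower bound uniform up to the line `Re s = 1`. It comes from the `3-4-1` inequality when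
`x ≥ x₀`, with `x₀` of order `logScale t ^ (-12)`, and for smaller `x` from the value at `x₀` and
the bound on the derivative, whose effect on an interval of length `x₀` is at most half of that
value. -/
lemma norm_zeta_ge {x t : ℝ} (hx : 0 < x) (hx1 : x ≤ 1) (ht : 1 ≤ |t|) :
    1 / (24 * 240 ^ 3) / logScale t ^ 10 ≤ ‖riemannZeta (1 + x + I * t)‖ := by
  have hL := two_le_logScale ht
  set L := logScale t with hLdef
  have hL0 : 0 < L := by linarith
  -- the threshold below which the derivative bound is used
  set x₀ : ℝ := (1 / 240) ^ 4 / L ^ 12 with hx₀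
  have hx₀0 : 0 < x₀ := by positivity
  have hx₀1 : x₀ ≤ 1 := by
    rw [hx₀, div_le_one (by positivity)]
    calc ((1 : ℝ) / 240) ^ 4 ≤ 1 := by norm_num
      _ ≤ L ^ 12 := one_le_pow₀ (by linarith)
  have key : ∀ y : ℝ, x₀ ≤ y → y ≤ 1 →
      (1 / 240) ^ 3 / (12 * L ^ 10) ≤ ‖riemannZeta (1 + y + I * t)‖ := by
    intro y hy hy1
    refine le_of_pow_le_pow_left₀ (n := 4) (by norm_num) (norm_nonneg _) ?_
    refine le_trans ?_ (pow_four_norm_zeta_ge (hx₀0.trans_le hy) hy1 ht)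
    have : x₀ ^ 3 ≤ y ^ 3 := by gcongr
    refine le_trans ?_ (div_le_div_of_nonneg_right this (by positivity))
    have ha : (0 : ℝ) < 1 / 240 := by norm_num
    rw [hx₀]
    generalize (1 / 240 : ℝ) = a at ha
    rw [div_pow, div_pow, div_div, ← pow_mul, ← pow_mul, mul_pow, ← pow_mul, ← pow_mul]
    refine div_le_div_of_nonneg_left (by positivity) (by positivity) ?_
    have : L ^ 37 ≤ L ^ 40 := pow_le_pow_right₀ (by linarith) (by norm_num)
    calc L ^ (12 * 3) * (16000 * logScale t) = 16000 * L ^ 37 := by rw [← hLdef]; ring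
      _ ≤ 12 ^ 4 * L ^ (10 * 4) := by norm_num; nlinarith [pow_pos hL0 40]
  rcases le_or_gt x₀ x with h | h
  · refine le_trans ?_ (key x h hx1)
    rw [div_div]
    have : (0 : ℝ) < L ^ 10 := by positivity
    rw [div_le_div_iff₀ (by positivity) (by positivity)]
    nlinarith
  · have h1 := key x₀ le_rfl hx₀1
    have hmv := (convex_Icc x x₀).norm_image_sub_le_of_norm_hasDerivWithin_le
      (f := fun y : ℝ => riemannZeta (1 + y + I * t))
      (f' := fun y : ℝ => deriv riemannZeta (1 + y + I * t)) (C := 10 * L ^ 2)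
      (fun y hy => by
        have hy0 : 0 < y := hx.trans_le hy.1
        have hne : (1 + y + I * t : ℂ) ≠ 1 := by
          intro he
          have := congrArg re he
          simp at this
          linarith
        have hz := (differentiableAt_riemannZeta hne).hasDerivAt
        have hl : HasDerivAt (fun y : ℝ => (1 + y + I * t : ℂ)) 1 y := by
          have := ((ofRealCLM.hasDerivAt (x := y)).const_add 1).add_const (I * t)
          simpa using! this
        have := hz.comp_of_eq y hl rfl
        simpa using! this.hasDerivWithinAt)
      (fun y hy => by
        have hy0 : 0 < y := hx.trans_le hy.1
        have hy1 : y ≤ 1 := hy.2.trans hx₀1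
        have := norm_deriv_zeta_le (s := 1 + y + I * t) (by simp; linarith) (by simp; linarith)
          (by simpa using ht)
        simpa using! this) (Set.left_mem_Icc.mpr h.le) (Set.right_mem_Icc.mpr h.le)
    have h2 : ‖x₀ - x‖ ≤ x₀ := by
      rw [Real.norm_of_nonneg (by linarith)]; linarith
    have h3 : 10 * L ^ 2 * ‖x₀ - x‖ ≤ 10 * (1 / 240) ^ 4 / L ^ 10 := by
      calc _ ≤ 10 * L ^ 2 * x₀ := by gcongr
        _ = _ := by rw [hx₀]; field_simp
    have h4 := norm_sub_norm_le (riemannZeta (1 + x₀ + I * t)) (riemannZeta (1 + x + I * t))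
    have h5 : (1 / 240 : ℝ) ^ 3 / (12 * L ^ 10) - 10 * (1 / 240) ^ 4 / L ^ 10
        = 1 / (24 * 240 ^ 3) / L ^ 10 := by
      field_simp
      norm_num
    linarith

/-- `s ↦ 1 / (s ζ(1 + s))`, with its removable singularity at `0` filled in. -/
noncomputable def invZeta₁ (s : ℂ) : ℂ := (riemannZeta₁ (1 + s))⁻¹

lemma riemannZeta₁_eq_mul {z : ℂ} (hz : z ≠ 1) : riemannZeta₁ z = (z - 1) * riemannZeta z := by
  rw [riemannZeta_eq_inv_sub_mul hz, mul_inv_cancel_left₀ (sub_ne_zero.mpr hz)]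

lemma riemannZeta₁_ne_zero {z : ℂ} (hz : 1 ≤ z.re) : riemannZeta₁ z ≠ 0 := by
  by_cases h : z = 1
  · simp [h]
  · rw [riemannZeta₁_eq_mul h]
    exact mul_ne_zero (sub_ne_zero.mpr h) (riemannZeta_ne_zero_of_one_le_re hz)

lemma hasDerivAt_invZeta₁ {s : ℂ} (hs : 0 ≤ s.re) :
    HasDerivAt invZeta₁ (-deriv riemannZeta₁ (1 + s) / riemannZeta₁ (1 + s) ^ 2) s := by
  have h1 := (differentiable_riemannZeta₁ (1 + s)).hasDerivAt
  have h2 : HasDerivAt (fun s => riemannZeta₁ (1 + s)) (deriv riemannZeta₁ (1 + s)) s := by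
    simpa using! h1.comp s ((hasDerivAt_id s).const_add 1)
  exact h2.fun_inv (riemannZeta₁_ne_zero (by simpa using hs))

lemma deriv_riemannZeta₁_eq {z : ℂ} (hz : z ≠ 1) :
    deriv riemannZeta₁ z = riemannZeta z + (z - 1) * deriv riemannZeta z := by
  have h1 : HasDerivAt (fun z => (z - 1) * riemannZeta z)
      (1 * riemannZeta z + (z - 1) * deriv riemannZeta z) z :=
    ((hasDerivAt_id z).sub_const 1).mul (differentiableAt_riemannZeta hz).hasDerivAt
  have h2 : riemannZeta₁ =ᶠ[nhds z] fun z => (z - 1) * riemannZeta z := by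
    filter_upwards [isOpen_compl_singleton.mem_nhds hz] with w hw using riemannZeta₁_eq_mul hw
  rw [h2.deriv_eq, h1.deriv, one_mul]

/-- The decay is `(log |t|)^22 / |t|`; the exponent `-3/4` absorbs the logarithms and is still
square integrable. -/
lemma exists_norm_deriv_invZeta₁_le_of_one_le :
    ∃ C : ℝ, 0 ≤ C ∧ ∀ x t : ℝ, 0 < x → x ≤ 1 → 1 ≤ |t| →
      ‖deriv invZeta₁ (x + I * t)‖ ≤ C * |t| ^ (-3 / 4 : ℝ) := by
  set c : ℝ := 1 / (24 * 240 ^ 3) with hc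
  have hc0 : 0 < c := by positivity
  refine ⟨38 * 178 ^ 22 / c ^ 2, by positivity, fun x t hx hx1 ht => ?_⟩
  have hL := two_le_logScale ht
  have ht0 : 0 < |t| := by linarith
  have hlow := norm_zeta_ge hx hx1 ht
  rw [← hc] at hlow
  have e : (1 + (x + I * t) : ℂ) = 1 + x + I * t := by ring
  have hne : (1 + x + I * t : ℂ) ≠ 1 := by
    intro he
    have := congrArg re he
    simp at this
    linarith
  have hζ : ‖riemannZeta (1 + x + I * t)‖ ≤ 8 * logScale t := by
    simpa using norm_zeta_le (s := 1 + x + I * t) (by simp; linarith) (by simp; linarith)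
          (by simpa using ht)
  have hζ' : ‖deriv riemannZeta (1 + x + I * t)‖ ≤ 10 * logScale t ^ 2 := by
    simpa using norm_deriv_zeta_le (s := 1 + x + I * t) (by simp; linarith) (by simp; linarith)
          (by simpa using ht)
  -- the `22` factors `logScale t` that arise below cost `|t| ^ (22 / 88) = |t| ^ (1 / 4)`;
  -- the constant is `178 = 2 + 2 * 88`
  have hlog : logScale t ≤ 178 * |t| ^ (1 / 88 : ℝ) := by
    have h1 := Real.log_le_rpow_div ht0.le (ε := 1 / 88) (by norm_num)
    have h2 : 1 ≤ |t| ^ (1 / 88 : ℝ) := Real.one_le_rpow ht (by norm_num)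
    unfold logScale
    linarith
  set L := logScale t with hLdef
  rw [(hasDerivAt_invZeta₁ (by simp [hx.le])).deriv, e, deriv_riemannZeta₁_eq hne,
    riemannZeta₁_eq_mul hne, norm_div, norm_neg, norm_pow, norm_mul]
  have es : (1 + x + I * t - 1 : ℂ) = x + I * t := by ring
  rw [es]
  have hs1 : |t| ≤ ‖(x + I * t : ℂ)‖ := by
    simpa using abs_im_le_norm (x + I * t : ℂ)
  have hs2 : ‖(x + I * t : ℂ)‖ ≤ 2 * |t| := by
    have := norm_le_abs_re_add_abs_im (x + I * t : ℂ)
    simp [abs_of_pos hx] at this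
    linarith
  have hL0 : 0 < L := by linarith
  calc _ ≤ (8 * L + 2 * |t| * (10 * L ^ 2)) / (|t| * (c / L ^ 10)) ^ 2 := by
        gcongr
        refine (norm_add_le _ _).trans ?_
        rw [norm_mul]
        gcongr
    _ ≤ (38 * |t| * L ^ 2) / (|t| * (c / L ^ 10)) ^ 2 := by
        gcongr
        nlinarith [mul_pos ht0 (pow_pos hL0 2), mul_le_mul ht hL (by norm_num) ht0.le]
    _ = 38 / c ^ 2 * L ^ 22 * |t|⁻¹ := by
        field_simp
    _ ≤ 38 / c ^ 2 * (178 * |t| ^ (1 / 88 : ℝ)) ^ 22 * |t|⁻¹ := by gcongr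
    _ = 38 * 178 ^ 22 / c ^ 2 * (|t| ^ (1 / 4 : ℝ) * |t| ^ (-1 : ℝ)) := by
        rw [mul_pow, ← Real.rpow_natCast (|t| ^ (1 / 88 : ℝ)), ← Real.rpow_mul ht0.le,
          Real.rpow_neg_one]
        norm_num
        ring
    _ = _ := by
        rw [← Real.rpow_add ht0]
        norm_num

/-- A square integrable majorant of the derivative of `1 / (s ζ(1 + s))` on vertical lines, uniform
as the lines approach the imaginary axis. -/
lemma exists_sq_norm_deriv_invZeta₁_le :
    ∃ C : ℝ, 0 ≤ C ∧ ∀ x t : ℝ, 0 < x → x ≤ 1 →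
      ‖deriv invZeta₁ (x + I * t)‖ ^ 2 ≤ C * (1 + ‖t‖) ^ (-(3 / 2) : ℝ) := by
  obtain ⟨C, hC, h⟩ := exists_norm_deriv_invZeta₁_le_of_one_le
  have hcont : ContinuousOn (fun p : ℝ × ℝ => ‖deriv invZeta₁ (p.1 + I * p.2)‖)
      (Set.Icc 0 1 ×ˢ Set.Icc (-1) 1) := by
    have : ContinuousOn (fun p : ℝ × ℝ => ‖-deriv riemannZeta₁ (1 + (p.1 + I * p.2)) /
        riemannZeta₁ (1 + (p.1 + I * p.2)) ^ 2‖) (Set.Icc 0 1 ×ˢ Set.Icc (-1) 1) := by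
      have c1 := differentiable_riemannZeta₁.continuous
      have c2 := differentiable_riemannZeta₁.deriv.continuous
      refine ContinuousOn.norm (ContinuousOn.div (by fun_prop) (by fun_prop) ?_)
      intro p hp
      exact pow_ne_zero _ (riemannZeta₁_ne_zero (by simpa using hp.1.1))
    refine this.congr fun p hp => ?_
    simp only
    rw [(hasDerivAt_invZeta₁ (by simpa using hp.1.1)).deriv]
  obtain ⟨D, hD⟩ := (isCompact_Icc.prod isCompact_Icc).exists_bound_of_continuousOn hcont
  have p2 : ∀ t : ℝ, 0 < 1 + ‖t‖ := fun t => by positivity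
  have hK : (0 : ℝ) < 2 ^ (3 / 2 : ℝ) := by positivity
  refine ⟨2 ^ (3 / 2 : ℝ) * (C ^ 2 + D ^ 2), by positivity, fun x t hx hx1 => ?_⟩
  rw [Real.rpow_neg (p2 t).le, ← div_eq_mul_inv, le_div_iff₀ (by have := p2 t; positivity)]
  rcases le_or_gt 1 |t| with ht | ht
  · have ht0 : 0 < |t| := by linarith
    have h1 := h x t hx hx1 ht
    have h2 : (1 + ‖t‖) ^ (3 / 2 : ℝ) ≤ 2 ^ (3 / 2 : ℝ) * |t| ^ (3 / 2 : ℝ) := by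
      rw [← Real.mul_rpow (by norm_num) ht0.le]
      refine Real.rpow_le_rpow (p2 t).le ?_ (by norm_num)
      rw [Real.norm_eq_abs]; linarith
    calc _ ≤ (C * |t| ^ (-3 / 4 : ℝ)) ^ 2 * (2 ^ (3 / 2 : ℝ) * |t| ^ (3 / 2 : ℝ)) := by gcongr
      _ = 2 ^ (3 / 2 : ℝ) * C ^ 2 * ((|t| ^ (-3 / 4 : ℝ)) ^ 2 * |t| ^ (3 / 2 : ℝ)) := by ring
      _ = 2 ^ (3 / 2 : ℝ) * C ^ 2 := by
          rw [← Real.rpow_natCast (|t| ^ (-3 / 4 : ℝ)), ← Real.rpow_mul ht0.le, ← Real.rpow_add ht0]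
          norm_num
      _ ≤ _ := by
          gcongr
          nlinarith [sq_nonneg D]
  · have h1 : ‖deriv invZeta₁ (x + I * t)‖ ≤ D := by
      simpa using hD (x, t) ⟨⟨hx.le, hx1⟩, abs_le.mp ht.le⟩
    have h2 : (1 + ‖t‖) ^ (3 / 2 : ℝ) ≤ 2 ^ (3 / 2 : ℝ) := by
      refine Real.rpow_le_rpow (p2 t).le ?_ (by norm_num)
      rw [Real.norm_eq_abs]; linarith
    calc _ ≤ D ^ 2 * 2 ^ (3 / 2 : ℝ) := by gcongr
      _ ≤ _ := by
          rw [mul_comm]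
          gcongr
          nlinarith [sq_nonneg C]

end

/-! ### Plancherel's formula -/

section

open MeasureTheory FourierTransform SchwartzMap

/-- Plancherel's formula for the Fourier integral of an integrable, square integrable function. It
follows from the isometry on `L²` because both transforms agree as tempered distributions. -/
lemma eLpNorm_fourier_eq {h : ℝ → ℂ} (h1 : Integrable h) (h2 : MemLp h 2) :
    eLpNorm (𝓕 h) 2 = eLpNorm h 2 := by
  set H : Lp ℂ 2 (volume : Measure ℝ) := h2.toLp h with hH
  have hae : (𝓕 H : Lp ℂ 2 (volume : Measure ℝ)) =ᵐ[volume] 𝓕 h := by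
    refine ae_eq_of_integral_contDiff_smul_eq ?_ ?_ ?_
    · exact (Lp.memLp _).locallyIntegrable (by norm_num)
    · exact (VectorFourier.fourierIntegral_continuous Real.continuous_fourierChar
        (by fun_prop : Continuous fun p : ℝ × ℝ => (innerₗ ℝ) p.1 p.2) h1).locallyIntegrable
    intro φ hφ hφc
    -- test both functions against `φ`, viewed as a Schwartz function
    set ψ : 𝓢(ℝ, ℂ) := (hφc.comp_left (g := Complex.ofReal) rfl).toSchwartzMap
      (Complex.ofRealCLM.contDiff.comp hφ) with hψ
    have hψφ : ∀ x, ψ x = (φ x : ℂ) := fun x => rfl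
    have key := DFunLike.congr_fun (Lp.fourier_toTemperedDistribution_eq H) ψ
    rw [TemperedDistribution.fourier_apply, Lp.toTemperedDistribution_apply,
      Lp.toTemperedDistribution_apply] at key
    have hL : ∫ x, (𝓕 ψ : 𝓢(ℝ, ℂ)) x • H x = ∫ x, (𝓕 ψ : 𝓢(ℝ, ℂ)) x • h x := by
      refine integral_congr_ae ?_
      filter_upwards [h2.coeFn_toLp] with x hx
      rw [hx]
    have hR : ∫ x, (𝓕 ψ : 𝓢(ℝ, ℂ)) x • h x = ∫ x, ψ x • 𝓕 h x := by
      simpa using! VectorFourier.integral_bilin_fourierIntegral_eq_flip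
        (ContinuousLinearMap.lsmul ℂ ℂ) (L := innerₗ ℝ)
        Real.continuous_fourierChar continuous_inner ψ.integrable h1
    rw [hL, hR] at key
    simpa [hψφ] using key.symm
  have e1 : eLpNorm (𝓕 h) 2 = eLpNorm (𝓕 H : Lp ℂ 2 (volume : Measure ℝ)) 2 :=
    (eLpNorm_congr_ae hae).symm
  have e2 : eLpNorm h 2 = eLpNorm H 2 := (eLpNorm_congr_ae h2.coeFn_toLp).symm
  have e3 := Lp.norm_fourier_eq H
  rw [e1, e2]
  rw [Lp.norm_def, Lp.norm_def] at e3
  exact (ENNReal.toReal_eq_toReal_iff' (Lp.eLpNorm_ne_top _) (Lp.eLpNorm_ne_top _)).mp e3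

end

/-! ### The logarithmic mean of the Möbius function as a Fourier transform -/

section

open Complex MeasureTheory Set Filter

/-- The logarithmic mean of the Möbius function, `u ↦ ∑_{n ≤ u} μ(n) / n`. -/
noncomputable def moebiusMean (u : ℝ) : ℂ :=
  ∑ n ∈ Finset.Icc 1 ⌊u⌋₊, (ArithmeticFunction.moebius n : ℂ) / n

lemma norm_moebius_div_le (n : ℕ) : ‖(ArithmeticFunction.moebius n : ℂ) / n‖ ≤ (n : ℝ)⁻¹ := by
  rw [norm_div, Complex.norm_natCast, div_eq_mul_inv]
  have : ‖(ArithmeticFunction.moebius n : ℂ)‖ ≤ 1 := by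
    rw [Complex.norm_intCast]
    exact_mod_cast ArithmeticFunction.abs_moebius_le_one
  exact mul_le_of_le_one_left (by positivity) this

lemma sum_Icc_inv_le (N : ℕ) : ∑ n ∈ Finset.Icc 1 N, (n : ℝ)⁻¹ ≤ 1 + Real.log N := by
  have := harmonic_le_one_add_log N
  rw [harmonic_eq_sum_Icc] at this
  push_cast at this
  exact this

lemma log_natFloor_le {u : ℝ} (hu : 1 ≤ u) : Real.log ⌊u⌋₊ ≤ Real.log u := by
  have : 1 ≤ ⌊u⌋₊ := Nat.one_le_floor_iff _ |>.mpr hu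
  exact Real.log_le_log (by exact_mod_cast this) (Nat.floor_le (by linarith))

lemma norm_moebiusMean_le {u : ℝ} (hu : 1 ≤ u) : ‖moebiusMean u‖ ≤ 1 + Real.log u :=
  (norm_sum_le_of_le _ fun n _ => norm_moebius_div_le n).trans
    ((sum_Icc_inv_le _).trans (by linarith [log_natFloor_le hu]))

lemma moebiusMean_of_lt_one {u : ℝ} (hu : u < 1) : moebiusMean u = 0 := by
  simp [moebiusMean, Nat.floor_eq_zero.mpr hu]

lemma measurable_moebiusMean : Measurable moebiusMean :=
  (measurable_from_nat (f := fun N => ∑ n ∈ Finset.Icc 1 N,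
    (ArithmeticFunction.moebius n : ℂ) / n)).comp Nat.measurable_floor

/-- Partial summation of `∑ μ(n) / n^(1+s) = 1 / ζ(1 + s)`. -/
lemma invZeta₁_eq_integral {s : ℂ} (hs : 0 < s.re) :
    invZeta₁ s = ∫ t in Ioi (1 : ℝ), moebiusMean t * (t : ℂ) ^ (-(s + 1)) := by
  have hs0 : s ≠ 0 := by rintro rfl; simp at hs
  have h1 : 1 < (1 + s).re := by simpa using hs
  have hne : 1 + s ≠ 1 := by simpa using hs0
  have hO : (fun n : ℕ => ∑ k ∈ Finset.Icc 1 n, ‖(ArithmeticFunction.moebius k : ℂ) / k‖)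
      =O[atTop] fun n : ℕ => (n : ℝ) ^ (s.re / 2) := by
    have hlog : (fun n : ℕ => 1 + Real.log n) =O[atTop] fun n : ℕ => (n : ℝ) ^ (s.re / 2) := by
      have : (fun x : ℝ => 1 + Real.log x) =O[atTop] fun x : ℝ => x ^ (s.re / 2) :=
        (Asymptotics.isLittleO_const_left.mpr (Or.inr (tendsto_norm_atTop_atTop.comp
          (tendsto_rpow_atTop (by linarith))))).isBigO.add
          (isLittleO_log_rpow_atTop (by linarith)).isBigO
      exact this.natCast_atTop
    refine (Asymptotics.IsBigO.of_bound 1 ?_).trans hlog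
    filter_upwards [eventually_ge_atTop 1] with n hn
    have hn1 : (1 : ℝ) ≤ n := by exact_mod_cast hn
    have h0 := Real.log_nonneg hn1
    rw [Real.norm_of_nonneg (by positivity), Real.norm_of_nonneg (by positivity), one_mul]
    exact (Finset.sum_le_sum fun k _ => norm_moebius_div_le k).trans (sum_Icc_inv_le n)
  have h := LSeries_eq_mul_integral' (fun n => (ArithmeticFunction.moebius n : ℂ) / n)
    (r := s.re / 2) (by linarith) (s := s) (by linarith) hO
  have e : LSeries (fun n => (ArithmeticFunction.moebius n : ℂ) / n) s =
      LSeries (fun n => (ArithmeticFunction.moebius n : ℂ)) (1 + s) := by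
    unfold LSeries
    congr 1
    ext n
    rw [LSeries.term_def, LSeries.term_def]
    split_ifs with hn
    · rfl
    · have : (n : ℂ) ≠ 0 := by exact_mod_cast hn
      rw [cpow_add _ _ this, cpow_one, div_div]
  have hz := LSeries_one_mul_Lseries_moebius h1
  rw [LSeries_one_eq_riemannZeta h1, ← e, h] at hz
  rw [invZeta₁, riemannZeta₁_eq_mul hne]
  refine inv_eq_of_mul_eq_one_right ?_
  refine Eq.trans ?_ hz
  unfold moebiusMean
  ring

/-- Since `moebiusMean` vanishes below `1`, the integral over `(1, ∞)` is a Mellin transform. -/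
lemma integral_eq_mellin (s : ℂ) :
    ∫ t in Ioi (1 : ℝ), moebiusMean t * (t : ℂ) ^ (-(s + 1)) = mellin moebiusMean (-s) := by
  have h0 : ∫ t in Ioi (0 : ℝ), (t : ℂ) ^ (-s - 1) • moebiusMean t =
      ∫ t in Ici (1 : ℝ), (t : ℂ) ^ (-s - 1) • moebiusMean t := by
    refine setIntegral_eq_of_subset_of_forall_sdiff_eq_zero measurableSet_Ioi ?_ ?_
    · intro x (hx : 1 ≤ x); exact lt_of_lt_of_le one_pos hx
    · intro x hx
      rw [moebiusMean_of_lt_one (not_le.mp hx.2), smul_zero]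
  rw [mellin, h0, integral_Ici_eq_integral_Ioi]
  refine setIntegral_congr_fun measurableSet_Ioi fun t _ => ?_
  simp only [smul_eq_mul]
  rw [mul_comm]
  congr 2
  ring

lemma moebiusMean_isBigO_atTop {r : ℝ} (hr : 0 < r) :
    moebiusMean =O[atTop] fun x : ℝ => x ^ r := by
  have hlog : (fun x : ℝ => 1 + Real.log x) =O[atTop] fun x : ℝ => x ^ r :=
    (Asymptotics.isLittleO_const_left.mpr (Or.inr (tendsto_norm_atTop_atTop.comp
      (tendsto_rpow_atTop hr)))).isBigO.add (isLittleO_log_rpow_atTop hr).isBigO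
  refine (Asymptotics.IsBigO.of_bound 1 ?_).trans hlog
  filter_upwards [eventually_ge_atTop 1] with x hx
  have := Real.log_nonneg hx
  rw [Real.norm_of_nonneg (by positivity), one_mul]
  exact norm_moebiusMean_le hx

lemma norm_moebiusMean_le_of_le {u B : ℝ} (hu : u ≤ B) (hB : 0 ≤ B) : ‖moebiusMean u‖ ≤ 1 + B := by
  rcases lt_or_ge u 1 with h | h
  · rw [moebiusMean_of_lt_one h, norm_zero]; linarith
  · have := Real.log_le_sub_one_of_pos (x := u) (by linarith)
    linarith [norm_moebiusMean_le h]

lemma locallyIntegrableOn_moebiusMean : LocallyIntegrableOn moebiusMean (Ioi 0) := by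
  refine LocallyIntegrable.locallyIntegrableOn (fun x => ?_) _
  refine ⟨Icc (x - 1) (x + 1), Icc_mem_nhds (by linarith) (by linarith), ?_⟩
  refine Measure.integrableOn_of_bounded (M := 1 + (|x| + 1)) (by simp)
    measurable_moebiusMean.aestronglyMeasurable ?_
  filter_upwards [ae_restrict_mem measurableSet_Icc] with u hu
  exact norm_moebiusMean_le_of_le (by linarith [hu.2, le_abs_self x]) (by positivity)

lemma deriv_invZeta₁_eq {s : ℂ} (hs : 0 < s.re) :
    deriv invZeta₁ s = - mellin (fun t => Real.log t • moebiusMean t) (-s) := by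
  have h := (mellin_hasDerivAt_of_isBigO_rpow (a := -(s.re / 2)) (b := -(s.re + 1)) (s := -s)
    (f := moebiusMean) locallyIntegrableOn_moebiusMean
    (by simpa using moebiusMean_isBigO_atTop (by linarith : 0 < s.re / 2))
    (by simp; linarith)
    (by
      refine (Asymptotics.isBigO_zero _ _).congr' ?_ .rfl
      filter_upwards [Ioo_mem_nhdsGT (zero_lt_one' ℝ)] with x hx
      rw [moebiusMean_of_lt_one hx.2])
    (by simp)).2
  have h2 : HasDerivAt (fun z => mellin moebiusMean (-z))
      (-mellin (fun t => Real.log t • moebiusMean t) (-s)) s := by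
    simpa using! h.comp s (hasDerivAt_neg s)
  have h3 : invZeta₁ =ᶠ[nhds s] fun z => mellin moebiusMean (-z) := by
    filter_upwards [(isOpen_lt continuous_const continuous_re).mem_nhds hs] with z hz
    rw [invZeta₁_eq_integral hz, integral_eq_mellin]
  rw [h3.deriv_eq, h2.deriv]

open FourierTransform in
/-- The substitution `t = e^v` turns the Mellin transform into a Fourier transform on the line
through `s`; differentiating in `s` brings out the factor `v`. -/
lemma deriv_invZeta₁_eq_fourier {s : ℂ} (hs : 0 < s.re) :
    deriv invZeta₁ s = - 𝓕 (fun v : ℝ => Real.exp (-s.re * v) • (v • moebiusMean (Real.exp v)))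
      (s.im / (2 * Real.pi)) := by
  rw [deriv_invZeta₁_eq hs, ← mellin_comp_inv, mellin_eq_fourier]
  simp [Real.exp_neg]

end

/-! ### Integrability of the logarithmic mean of the Möbius function -/

section

open Complex MeasureTheory Set Filter FourierTransform

lemma norm_moebiusMean_exp_le {v : ℝ} (hv : 0 ≤ v) : ‖moebiusMean (Real.exp v)‖ ≤ 1 + v := by
  simpa using norm_moebiusMean_le (Real.one_le_exp hv)

lemma moebiusMean_exp_of_neg {v : ℝ} (hv : v < 0) : moebiusMean (Real.exp v) = 0 :=
  moebiusMean_of_lt_one (Real.exp_lt_one_iff.mpr hv)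

lemma measurable_moebiusMean_exp : Measurable fun v : ℝ => moebiusMean (Real.exp v) :=
  measurable_moebiusMean.comp Real.measurable_exp

/-- The function `v ↦ e^(-av) v m(e^v)`, where `m = moebiusMean`. -/
noncomputable def dampedMean (a v : ℝ) : ℂ := Real.exp (-a * v) • (v • moebiusMean (Real.exp v))

lemma measurable_dampedMean (a : ℝ) : Measurable (dampedMean a) := by
  unfold dampedMean
  have := measurable_moebiusMean_exp
  fun_prop

/-- The trivial bound `‖m(e^v)‖ ≤ 1 + v` already makes the damped function exponentially small. -/
lemma norm_dampedMean_le {a : ℝ} (ha : 0 < a) (v : ℝ) :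
    ‖dampedMean a v‖ ≤ (Ioi (0 : ℝ)).indicator
      (fun v => 4 / a * (1 + 4 / a) * Real.exp (-(a / 2) * v)) v := by
  rcases le_or_gt v 0 with h | h
  · rw [indicator_of_notMem (by simpa using h)]
    rcases h.eq_or_lt with rfl | h
    · simp [dampedMean]
    · simp [dampedMean, moebiusMean_exp_of_neg h]
  · rw [indicator_of_mem (by exact h), dampedMean, norm_smul, norm_smul, Real.norm_of_nonneg
      (Real.exp_pos _).le, Real.norm_of_nonneg h.le]
    have h1 : v ≤ 4 / a * Real.exp (a / 4 * v) := by
      have := Real.add_one_le_exp (a / 4 * v)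
      calc v = 4 / a * (a / 4 * v) := by field_simp
        _ ≤ _ := by gcongr; linarith
    have h2 : 1 ≤ Real.exp (a / 4 * v) := Real.one_le_exp (by positivity)
    have h3 : 1 + v ≤ (1 + 4 / a) * Real.exp (a / 4 * v) := by linarith
    have h4 := norm_moebiusMean_exp_le h.le
    calc _ ≤ Real.exp (-a * v) * ((4 / a * Real.exp (a / 4 * v)) *
          ((1 + 4 / a) * Real.exp (a / 4 * v))) := by
          gcongr
          exact h4.trans h3
      _ = 4 / a * (1 + 4 / a) *
          (Real.exp (-a * v) * Real.exp (a / 4 * v) * Real.exp (a / 4 * v)) := by ring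
      _ = _ := by
          rw [← Real.exp_add, ← Real.exp_add]
          ring_nf

lemma integrable_indicator_exp {b : ℝ} (hb : 0 < b) (K : ℝ) :
    Integrable ((Ioi (0 : ℝ)).indicator (fun v => K * Real.exp (-b * v))) :=
  (integrable_indicator_iff measurableSet_Ioi).mpr ((exp_neg_integrableOn_Ioi 0 hb).const_mul K)

lemma integrable_dampedMean {a : ℝ} (ha : 0 < a) : Integrable (dampedMean a) :=
  (integrable_indicator_exp (by linarith) _).mono' (measurable_dampedMean a).aestronglyMeasurable
    (Eventually.of_forall (norm_dampedMean_le ha))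

lemma memLp_dampedMean {a : ℝ} (ha : 0 < a) : MemLp (dampedMean a) 2 := by
  rw [memLp_two_iff_integrable_sq_norm (measurable_dampedMean a).aestronglyMeasurable]
  refine (integrable_indicator_exp (b := a) ha ((4 / a * (1 + 4 / a)) ^ 2)).mono'
    ((measurable_dampedMean a).norm.pow_const 2).aestronglyMeasurable
    (Eventually.of_forall fun v => ?_)
  have h := norm_dampedMean_le ha v
  rw [Real.norm_of_nonneg (by positivity)]
  refine (pow_le_pow_left₀ (norm_nonneg _) h 2).trans (le_of_eq ?_)
  by_cases hv : v ∈ Ioi (0 : ℝ)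
  · rw [indicator_of_mem hv, indicator_of_mem hv, mul_pow, ← Real.exp_nat_mul]
    congr 2
    push_cast
    ring
  · rw [indicator_of_notMem hv, indicator_of_notMem hv]
    norm_num

/-- By Plancherel, the `L²` norms of the damped functions stay bounded as the damping is removed. -/
lemma exists_lintegral_sq_dampedMean_le :
    ∃ D : NNReal, ∀ a : ℝ, 0 < a → a ≤ 1 → ∫⁻ v, ‖dampedMean a v‖ₑ ^ 2 ≤ D := by
  obtain ⟨C, hC, h⟩ := exists_sq_norm_deriv_invZeta₁_le
  have hint : Integrable (fun x : ℝ => C * (1 + ‖x‖) ^ (-(3 / 2) : ℝ)) :=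
    (integrable_one_add_norm (by simp; norm_num)).const_mul C
  refine ⟨(∫⁻ x : ℝ, ENNReal.ofReal (C * (1 + ‖x‖) ^ (-(3 / 2) : ℝ))).toNNReal,
    fun a ha ha1 => ?_⟩
  rw [ENNReal.coe_toNNReal hint.lintegral_lt_top.ne]
  have key : ∀ g : ℝ → ℂ, ∫⁻ v, ‖g v‖ₑ ^ 2 = eLpNorm g 2 ^ 2 := by
    intro g
    have := eLpNorm_nnreal_pow_eq_lintegral (μ := volume) (f := g) (p := 2) (by norm_num)
    simpa using this.symm
  rw [key, ← eLpNorm_fourier_eq (integrable_dampedMean ha) (memLp_dampedMean ha), ← key]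
  refine lintegral_mono fun ξ => ?_
  have e := deriv_invZeta₁_eq_fourier (s := a + I * (2 * Real.pi * ξ : ℝ)) (by simpa using ha)
  have e1 : (a + I * (2 * Real.pi * ξ : ℝ) : ℂ).re = a := by simp
  have e2 : (a + I * (2 * Real.pi * ξ : ℝ) : ℂ).im / (2 * Real.pi) = ξ := by
    simp
  rw [e1, e2] at e
  have e3 : ‖𝓕 (dampedMean a) ξ‖ = ‖deriv invZeta₁ (a + I * (2 * Real.pi * ξ : ℝ))‖ := by
    rw [e, norm_neg]; rfl
  rw [← ofReal_norm, ← ENNReal.ofReal_pow (norm_nonneg _), e3]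
  refine ENNReal.ofReal_le_ofReal ((h a _ ha ha1).trans ?_)
  refine mul_le_mul_of_nonneg_left ?_ hC
  refine Real.rpow_le_rpow_of_nonpos (by positivity) ?_ (by norm_num)
  rw [norm_mul, Real.norm_of_nonneg (by positivity : 0 ≤ 2 * Real.pi)]
  have := Real.pi_gt_three
  nlinarith [norm_nonneg ξ]

/-- The inequality `y ≤ (v y)² + v⁻²` bounds an integral in terms of a weighted `L²` norm
and a convergent integral. -/
lemma enorm_exp_smul_le {a v : ℝ} (hv : 1 < v) :
    ‖Real.exp (-a * v) • moebiusMean (Real.exp v)‖ₑ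
      ≤ ‖dampedMean a v‖ₑ ^ 2 + ENNReal.ofReal (v ^ (-2 : ℝ)) := by
  have hv0 : 0 < v := by linarith
  rw [← ofReal_norm, ← ofReal_norm, ← ENNReal.ofReal_pow (norm_nonneg _),
    ← ENNReal.ofReal_add (by positivity) (by positivity)]
  refine ENNReal.ofReal_le_ofReal ?_
  have e : ‖dampedMean a v‖ = v * ‖Real.exp (-a * v) • moebiusMean (Real.exp v)‖ := by
    rw [dampedMean, smul_comm, norm_smul, Real.norm_of_nonneg hv0.le]
  set y := ‖Real.exp (-a * v) • moebiusMean (Real.exp v)‖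
  have h2 : v ^ (-2 : ℝ) = v⁻¹ ^ 2 := by
    rw [Real.rpow_neg hv0.le, inv_pow]; norm_cast
  have h3 : y = (v * y) * v⁻¹ := by field_simp
  rw [e, h2]
  nlinarith [sq_nonneg (v * y - v⁻¹), sq_nonneg (v * y), sq_nonneg v⁻¹]

/-- The form of the prime number theorem that is used: `∑_{n ≤ u} μ(n)/n` is integrable with respect
to `du/u`. The uniform `L²` bound passes to the limit by Fatou's lemma. -/
lemma integrable_moebiusMean_exp : Integrable fun v : ℝ => moebiusMean (Real.exp v) := by
  have hmeas := measurable_moebiusMean_exp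
  have hloc : IntegrableOn (fun v : ℝ => moebiusMean (Real.exp v)) (Iic 1) := by
    have h1 : IntegrableOn (fun v : ℝ => moebiusMean (Real.exp v)) (Icc 0 1) := by
      refine Measure.integrableOn_of_bounded (M := 2) (by simp) hmeas.aestronglyMeasurable ?_
      filter_upwards [ae_restrict_mem measurableSet_Icc] with u hu
      linarith [norm_moebiusMean_exp_le hu.1, hu.2]
    have h2 : IntegrableOn (fun v : ℝ => moebiusMean (Real.exp v)) (Iio 0) :=
      integrableOn_zero.congr_fun (fun v hv => (moebiusMean_exp_of_neg hv).symm) measurableSet_Iio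
    have := h2.union h1
    rwa [Iio_union_Icc_eq_Iic zero_le_one] at this
  have htail : IntegrableOn (fun v : ℝ => moebiusMean (Real.exp v)) (Ioi 1) := by
    refine ⟨hmeas.aestronglyMeasurable, ?_⟩
    obtain ⟨D, hD⟩ := exists_lintegral_sq_dampedMean_le
    let a : ℕ → ℝ := fun n => 1 / ((n : ℝ) + 1)
    have hint : IntegrableOn (fun v : ℝ => v ^ (-2 : ℝ)) (Ioi 1) :=
      integrableOn_Ioi_rpow_of_lt (by norm_num) one_pos
    have hlim : ∀ v : ℝ, ‖moebiusMean (Real.exp v)‖ₑ =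
        liminf (fun n => ‖Real.exp (-a n * v) • moebiusMean (Real.exp v)‖ₑ) atTop := by
      intro v
      have h1 : Tendsto a atTop (nhds 0) := tendsto_one_div_add_atTop_nhds_zero_nat
      have h2 : Tendsto (fun n => Real.exp (-a n * v)) atTop (nhds 1) := by
        have := (Real.continuous_exp.tendsto _).comp ((h1.neg).mul_const v)
        simpa using! this
      have h3 := (h2.smul_const (moebiusMean (Real.exp v))).enorm
      rw [one_smul] at h3
      exact h3.liminf_eq.symm
    have : ∫⁻ v in Ioi 1, ‖moebiusMean (Real.exp v)‖ₑ ≤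
        D + ∫⁻ v in Ioi (1 : ℝ), ENNReal.ofReal (v ^ (-2 : ℝ)) := by
      calc _ = ∫⁻ v in Ioi 1, liminf (fun n =>
            ‖Real.exp (-a n * v) • moebiusMean (Real.exp v)‖ₑ) atTop := by
            simp_rw [← hlim]
        _ ≤ liminf (fun n => ∫⁻ v in Ioi 1,
            ‖Real.exp (-a n * v) • moebiusMean (Real.exp v)‖ₑ) atTop := by
            refine lintegral_liminf_le fun n => ?_
            fun_prop
        _ ≤ _ := by
            refine liminf_le_of_frequently_le' (Frequently.of_forall fun n => ?_)
            calc _ ≤ ∫⁻ v in Ioi (1 : ℝ), (‖dampedMean (a n) v‖ₑ ^ 2 +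
                    ENNReal.ofReal (v ^ (-2 : ℝ))) :=
                  setLIntegral_mono' measurableSet_Ioi fun v hv => enorm_exp_smul_le hv
              _ = _ := lintegral_add_left ((measurable_dampedMean _).enorm.pow_const 2) _
              _ ≤ _ := by
                  gcongr
                  refine (setLIntegral_le_lintegral _ _).trans (hD (a n) ?_ ?_)
                  · exact Nat.one_div_pos_of_nat
                  · simp only [a]
                    rw [div_le_one (by positivity)]
                    linarith [(Nat.cast_nonneg n : (0 : ℝ) ≤ n)]
    exact this.trans_lt (ENNReal.add_lt_top.mpr ⟨ENNReal.coe_lt_top, hint.lintegral_lt_top⟩)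
  have := hloc.union htail
  rwa [Iic_union_Ioi, integrableOn_univ] at this

end

/-! ### Products of weights over the prime divisors -/

section

open ArithmeticFunction Finset

section PrimeProduct

variable {w : ℕ → ℝ}

lemma prodPrimeFactors_nonneg (hw : ∀ p : ℕ, p.Prime → 0 ≤ w p) (n : ℕ) :
    0 ≤ prodPrimeFactors w n := by
  rcases eq_or_ne n 0 with rfl | hn
  · simp
  · rw [prodPrimeFactors_apply hn]
    exact prod_nonneg fun p hp => hw p (Nat.prime_of_mem_primeFactors hp)

lemma prodPrimeFactors_prime_pow {p k : ℕ} (hp : p.Prime) (hk : k ≠ 0) :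
    prodPrimeFactors w (p ^ k) = w p := by
  rw [prodPrimeFactors_apply (pow_ne_zero _ hp.ne_zero), Nat.primeFactors_prime_pow hk hp,
    prod_singleton]

lemma prodPrimeFactors_mul_le (hw : ∀ p : ℕ, p.Prime → 0 ≤ w p) (hw2 : ∀ p : ℕ, p.Prime → w p ≤ 2)
    (m : ℕ) {k : ℕ} (hk : IsPrimePow k) :
    prodPrimeFactors w (m * k) ≤ 2 * prodPrimeFactors w m := by
  rcases eq_or_ne m 0 with rfl | hm
  · simp
  obtain ⟨p, j, hp, hj, rfl⟩ := hk
  have hp := hp.nat_prime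
  have hpj : p ^ j ≠ 0 := pow_ne_zero _ hp.ne_zero
  rw [prodPrimeFactors_apply (mul_ne_zero hm hpj), prodPrimeFactors_apply hm,
    Nat.primeFactors_mul hm hpj, Nat.primeFactors_prime_pow hj.ne' hp]
  have h0 : 0 ≤ ∏ p ∈ m.primeFactors, w p :=
    prod_nonneg fun p hp => hw p (Nat.prime_of_mem_primeFactors hp)
  by_cases h : p ∈ m.primeFactors
  · rw [union_eq_left.mpr (by simpa using h)]
    linarith
  · rw [prod_union (by simpa using h), prod_singleton, mul_comm]
    exact mul_le_mul_of_nonneg_right (hw2 p hp) h0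

/-- A factor `log n` is gained from `log = Λ * 1`: with `G = prodPrimeFactors w`, one has
`G(mk) ≤ 2 G(m)` for prime powers `k`, so that the sum of `G(n) log n` is at most twice that of
`G * Λ`, which Chebyshev's bound `ψ(x) ≪ x` controls. -/
lemma sum_prodPrimeFactors_mul_log_le (hw : ∀ p : ℕ, p.Prime → 0 ≤ w p)
    (hw2 : ∀ p : ℕ, p.Prime → w p ≤ 2) (N : ℕ) :
    ∑ n ∈ Ioc 0 N, prodPrimeFactors w n * Real.log n ≤
      2 * (Real.log 4 + 4) * N * ∑ n ∈ Ioc 0 N, prodPrimeFactors w n / n := by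
  have h1 : ∀ n, prodPrimeFactors w n * Real.log n ≤ 2 * (prodPrimeFactors w * Λ) n := by
    intro n
    rw [mul_apply, ← vonMangoldt_sum, ← Nat.sum_divisorsAntidiagonal' (f := fun _ k => Λ k),
      mul_sum, mul_sum]
    refine sum_le_sum fun x hx => ?_
    rw [← (Nat.mem_divisorsAntidiagonal.mp hx).1, ← mul_assoc]
    by_cases hk : IsPrimePow x.2
    · exact mul_le_mul_of_nonneg_right (prodPrimeFactors_mul_le hw hw2 x.1 hk) vonMangoldt_nonneg
    · simp [vonMangoldt_eq_zero_iff.mpr hk]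
  have h2 : ∑ n ∈ Ioc 0 N, (prodPrimeFactors w * Λ) n ≤
      ∑ n ∈ Ioc 0 N, prodPrimeFactors w n * ((Real.log 4 + 4) * (N / n)) := by
    rw [sum_Ioc_mul_eq_sum_sum]
    refine sum_le_sum fun n _ => mul_le_mul_of_nonneg_left ?_ (prodPrimeFactors_nonneg hw n)
    have h3 := Chebyshev.psi_le_const_mul_self (x := ((N / n : ℕ) : ℝ)) (by positivity)
    have h4 : Chebyshev.psi ((N / n : ℕ) : ℝ) = ∑ m ∈ Ioc 0 (N / n), Λ m := by
      rw [Chebyshev.psi, Nat.floor_natCast]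
    rw [← h4]
    refine h3.trans ?_
    have : 0 ≤ Real.log 4 := Real.log_nonneg (by norm_num)
    gcongr
    exact Nat.cast_div_le
  calc _ ≤ ∑ n ∈ Ioc 0 N, 2 * (prodPrimeFactors w * Λ) n := sum_le_sum fun n _ => h1 n
    _ ≤ 2 * ∑ n ∈ Ioc 0 N, prodPrimeFactors w n * ((Real.log 4 + 4) * (N / n)) := by
        rw [← mul_sum]; linarith
    _ = _ := by
        rw [mul_sum, mul_sum]
        exact sum_congr rfl fun n _ => by ring

/-- An Euler factor `1 + a (r + r² + ⋯)` against the exponential of its linear term, up to a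
quadratic error. -/
lemma exp_ge_one_add_geom {a r : ℝ} (ha : 0 ≤ a) (ha2 : a ≤ 2) (hr : 0 ≤ r) (hr2 : r ≤ 1 / 2) :
    1 + a * (r / (1 - r)) ≤ Real.exp (a * r + 4 * r ^ 2) := by
  have h1 : r / (1 - r) ≤ r + 2 * r ^ 2 := by
    rw [div_le_iff₀ (by linarith)]
    have h0 := mul_nonneg (sq_nonneg r) hr
    nlinarith [sq_nonneg r]
  have h2 := Real.add_one_le_exp (a * r + 4 * r ^ 2)
  nlinarith [mul_le_mul_of_nonneg_left h1 ha, sq_nonneg r]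

lemma prime_rpow_neg_le_half {p : ℕ} (hp : p.Prime) {σ : ℝ} (hσ : 1 ≤ σ) :
    (p : ℝ) ^ (-σ) ≤ 1 / 2 := by
  have hp2 : (2 : ℝ) ≤ p := by exact_mod_cast hp.two_le
  calc (p : ℝ) ^ (-σ) ≤ (p : ℝ) ^ (-1 : ℝ) :=
        Real.rpow_le_rpow_of_exponent_le (by linarith) (by linarith)
    _ ≤ 1 / 2 := by
        rw [Real.rpow_neg_one, one_div]
        exact inv_anti₀ (by norm_num) hp2

/-- The Euler factor of a function that is constant on the powers `p^k`, `k ≥ 1`. -/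
lemma hasSum_prime_pow_mul_rpow {g : ArithmeticFunction ℝ} (hg1 : g 1 = 1) {p : ℕ} {c : ℝ}
    (hg : ∀ k ≠ 0, g (p ^ k) = c) (hp : p.Prime) {σ : ℝ} (hσ : 1 ≤ σ) :
    HasSum (fun k : ℕ => g (p ^ k) * ((p ^ k : ℕ) : ℝ) ^ (-σ))
      (1 + c * ((p : ℝ) ^ (-σ) / (1 - (p : ℝ) ^ (-σ)))) := by
  have hr0 : 0 ≤ (p : ℝ) ^ (-σ) := by positivity
  have hr2 := prime_rpow_neg_le_half hp hσ
  set r := (p : ℝ) ^ (-σ) with hr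
  have hpk : ∀ k : ℕ, g (p ^ (k + 1)) * ((p ^ (k + 1) : ℕ) : ℝ) ^ (-σ) = c * (r * r ^ k) := by
    intro k
    rw [hg _ (Nat.succ_ne_zero k), ← pow_succ', hr]
    congr 1
    rw [Nat.cast_pow, ← Real.rpow_natCast, ← Real.rpow_natCast, ← Real.rpow_mul (by positivity),
      ← Real.rpow_mul (by positivity), mul_comm]
  have hs : HasSum (fun k : ℕ => g (p ^ (k + 1)) * ((p ^ (k + 1) : ℕ) : ℝ) ^ (-σ))
      (c * (r / (1 - r))) := by
    simp_rw [hpk]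
    exact ((hasSum_geometric_of_lt_one hr0 (by linarith)).mul_left r).mul_left c
  have := (hasSum_nat_add_iff (f := fun k => g (p ^ k) * ((p ^ k : ℕ) : ℝ) ^ (-σ)) 1).mp hs
  rw [sum_range_one, pow_zero, hg1, Nat.cast_one, Real.one_rpow, mul_one, add_comm] at this
  exact this

/-- A Dirichlet polynomial with nonnegative multiplicative coefficients that depend only on the
prime divisors, bounded through its Euler product over the primes `p ≤ N`. -/
lemma sum_mul_rpow_le {g : ArithmeticFunction ℝ} (hmult : g.IsMultiplicative)
    (hg0 : ∀ n, 0 ≤ g n) (hg : ∀ p : ℕ, p.Prime → ∀ k ≠ 0, g (p ^ k) = w p)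
    (hw2 : ∀ p : ℕ, p.Prime → w p ≤ 2) {σ : ℝ} (hσ : 1 ≤ σ) (N : ℕ) :
    ∑ n ∈ Ioc 0 N, g n * (n : ℝ) ^ (-σ) ≤
      Real.exp (∑ p ∈ (N + 1).primesBelow, (w p * (p : ℝ) ^ (-σ) + 4 * ((p : ℝ) ^ (-σ)) ^ 2)) := by
  have h0 : ∀ n : ℕ, 0 ≤ g n * (n : ℝ) ^ (-σ) := fun n => mul_nonneg (hg0 n) (by positivity)
  have h1 : g 1 * ((1 : ℕ) : ℝ) ^ (-σ) = 1 := by simp [hmult.1]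
  have hmul : ∀ {m n : ℕ}, m.Coprime n → g (m * n) * ((m * n : ℕ) : ℝ) ^ (-σ) =
      (g m * (m : ℝ) ^ (-σ)) * (g n * (n : ℝ) ^ (-σ)) := by
    intro m n hmn
    rw [hmult.2 hmn, Nat.cast_mul, Real.mul_rpow (by positivity) (by positivity)]
    ring
  have hloc := fun (p : ℕ) (hp : p.Prime) =>
    hasSum_prime_pow_mul_rpow hmult.1 (hg p hp) hp hσ
  have hE := EulerProduct.summable_and_hasSum_smoothNumbers_prod_primesBelow_tsum
    (f := fun n : ℕ => g n * (n : ℝ) ^ (-σ)) h1 hmul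
    (fun {p} hp => (hloc p hp).summable.norm) (N + 1)
  have hS := (hasSum_subtype_iff_indicator (f := fun n : ℕ => g n * (n : ℝ) ^ (-σ))
    (s := (N + 1).smoothNumbers)).mp hE.2
  have hle := sum_le_hasSum (Ioc 0 N)
    (fun n _ => Set.indicator_nonneg (fun n _ => h0 n) n) hS
  have heq : ∑ n ∈ Ioc 0 N, (Set.indicator (N + 1).smoothNumbers
      (fun n : ℕ => g n * (n : ℝ) ^ (-σ))) n = ∑ n ∈ Ioc 0 N, g n * (n : ℝ) ^ (-σ) := by
    refine sum_congr rfl fun n hn => Set.indicator_of_mem ?_ _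
    rw [mem_Ioc] at hn
    exact Nat.mem_smoothNumbers_of_lt hn.1 (by omega)
  rw [heq] at hle
  refine hle.trans ?_
  rw [Real.exp_sum]
  refine prod_le_prod (fun p hp => tsum_nonneg fun k => h0 _) fun p hp => ?_
  have hp := Nat.prime_of_mem_primesBelow hp
  rw [(hloc p hp).tsum_eq]
  refine exp_ge_one_add_geom ?_ (hw2 p hp) (by positivity) (prime_rpow_neg_le_half hp hσ)
  rw [← hg p hp 1 one_ne_zero]
  exact hg0 _

end PrimeProduct

end

/-! ### Sums over the primes -/

section

open ArithmeticFunction Finset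

lemma summable_primes_rpow_neg {σ : ℝ} (hσ : 1 < σ) :
    Summable fun p : Nat.Primes => ((p : ℕ) : ℝ) ^ (-σ) :=
  Nat.Primes.summable_rpow.mpr (by linarith)

/-- The sum `4 ∑ p⁻²`, which bounds the contribution of the higher prime powers. -/
noncomputable def primeSquareSum : ℝ := ∑' p : Nat.Primes, 4 * (((p : ℕ) : ℝ) ^ (-2 : ℝ))

lemma summable_primeSquare : Summable fun p : Nat.Primes => 4 * (((p : ℕ) : ℝ) ^ (-2 : ℝ)) :=
  (summable_primes_rpow_neg (by norm_num)).mul_left 4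

lemma sq_prime_rpow_neg_le (p : Nat.Primes) {σ : ℝ} (hσ : 1 ≤ σ) :
    (((p : ℕ) : ℝ) ^ (-σ)) ^ 2 ≤ ((p : ℕ) : ℝ) ^ (-2 : ℝ) := by
  have hp : (1 : ℝ) ≤ (p : ℕ) := by exact_mod_cast p.2.one_lt.le
  rw [← Real.rpow_natCast, ← Real.rpow_mul (by positivity)]
  exact Real.rpow_le_rpow_of_exponent_le hp (by push_cast; linarith)

lemma neg_log_one_sub_ge {r : ℝ} (hr2 : r ≤ 1 / 2) : r ≤ -Real.log (1 - r) := by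
  have := Real.log_le_sub_one_of_pos (x := 1 - r) (by linarith)
  linarith

lemma neg_log_one_sub_le {r : ℝ} (hr : 0 ≤ r) (hr2 : r ≤ 1 / 2) :
    -Real.log (1 - r) ≤ r + 4 * r ^ 2 := by
  rw [← Real.log_inv]
  have h0 : 0 < 1 - r := by linarith
  have := Real.log_le_sub_one_of_pos (x := (1 - r)⁻¹) (by positivity)
  have h1 : (1 - r)⁻¹ ≤ 1 + r + 4 * r ^ 2 := by
    rw [inv_le_iff_one_le_mul₀ h0]
    have h2 := mul_nonneg (sq_nonneg r) hr
    nlinarith [sq_nonneg r]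
  linarith

section
variable {a : ℝ}

lemma summable_neg_log_one_sub_prime (ha : 0 < a) :
    Summable fun p : Nat.Primes => -Real.log (1 - ((p : ℕ) : ℝ) ^ (-(1 + a))) := by
  refine Summable.of_nonneg_of_le (fun p => ?_) (fun p => ?_)
    ((summable_primes_rpow_neg (by linarith : 1 < 1 + a)).add summable_primeSquare)
  · exact (by positivity : 0 ≤ ((p : ℕ) : ℝ) ^ (-(1 + a))).trans
      (neg_log_one_sub_ge (prime_rpow_neg_le_half p.2 (by linarith)))
  · refine (neg_log_one_sub_le (by positivity) (prime_rpow_neg_le_half p.2 (by linarith))).trans ?_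
    have := sq_prime_rpow_neg_le p (by linarith : 1 ≤ 1 + a)
    linarith

lemma norm_zeta_eq_exp (ha : 0 < a) :
    ‖riemannZeta (1 + a)‖ =
      Real.exp (∑' p : Nat.Primes, -Real.log (1 - ((p : ℕ) : ℝ) ^ (-(1 + a)))) := by
  have h := riemannZeta_eulerProduct_exp_log (s := 1 + a) (by simpa using ha)
  have e : ∀ p : Nat.Primes, -Complex.log (1 - ((p : ℕ) : ℂ) ^ (-(1 + a : ℂ))) =
      ((-Real.log (1 - ((p : ℕ) : ℝ) ^ (-(1 + a))) : ℝ) : ℂ) := by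
    intro p
    have hr := prime_rpow_neg_le_half p.2 (by linarith : 1 ≤ 1 + a)
    push_cast
    rw [Complex.ofReal_log (by linarith)]
    push_cast
    rw [Complex.ofReal_cpow (by positivity)]
    push_cast
    rfl
  simp_rw [e] at h
  rw [← Complex.ofReal_tsum, ← Complex.ofReal_exp] at h
  rw [← h, Complex.norm_real, Real.norm_of_nonneg (Real.exp_pos _).le]

/-- Upper half of Mertens' estimate `∑ p^(-1-a) = log (1/a) + O(1)`. -/
lemma exp_tsum_primes_le (ha : 0 < a) (ha1 : a ≤ 1) :
    Real.exp (∑' p : Nat.Primes, ((p : ℕ) : ℝ) ^ (-(1 + a))) ≤ 10 / a := by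
  refine le_trans ?_ (norm_zeta_one_add_le ha ha1)
  rw [norm_zeta_eq_exp ha]
  refine Real.exp_le_exp.mpr (Summable.tsum_le_tsum (fun p => ?_)
    (summable_primes_rpow_neg (by linarith)) (summable_neg_log_one_sub_prime ha))
  exact neg_log_one_sub_ge (prime_rpow_neg_le_half p.2 (by linarith))

/-- Lower half of Mertens' estimate, with `ζ(1 + a)` in place of `1/a`. -/
lemma norm_zeta_le_exp_tsum_primes (ha : 0 < a) :
    ‖riemannZeta (1 + a)‖ ≤
      Real.exp primeSquareSum * Real.exp (∑' p : Nat.Primes, ((p : ℕ) : ℝ) ^ (-(1 + a))) := by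
  have hs := summable_primes_rpow_neg (by linarith : 1 < 1 + a)
  rw [norm_zeta_eq_exp ha, ← Real.exp_add, primeSquareSum, ← summable_primeSquare.tsum_add hs]
  refine Real.exp_le_exp.mpr (Summable.tsum_le_tsum (fun p => ?_)
    (summable_neg_log_one_sub_prime ha) (summable_primeSquare.add hs))
  have h1 := neg_log_one_sub_le (by positivity)
    (prime_rpow_neg_le_half p.2 (by linarith : 1 ≤ 1 + a))
  have := sq_prime_rpow_neg_le p (by linarith : 1 ≤ 1 + a)
  linarith

lemma sum_primesBelow_le_tsum {F : ℕ → ℝ} (hF : ∀ p : Nat.Primes, 0 ≤ F p)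
    (hs : Summable fun p : Nat.Primes => F p) (N : ℕ) :
    ∑ p ∈ N.primesBelow, F p ≤ ∑' p : Nat.Primes, F p := by
  have e : ∑ p ∈ N.primesBelow, F p = ∑ p ∈ N.primesBelow.subtype Nat.Prime, F p := by
    rw [sum_subtype_of_mem _ fun p hp => Nat.prime_of_mem_primesBelow hp]
  rw [e]
  exact Summable.sum_le_tsum (f := fun p : Nat.Primes => F p) _ (fun p _ => hF p) hs

end

/-- The sum `∑_p w(p)² p^(-1-a)` over the primes. -/
noncomputable def primeWeightSum (w : ℕ → ℝ) (a : ℝ) : ℝ :=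
  ∑' p : Nat.Primes, w p ^ 2 / ((p : ℕ) : ℝ) ^ (1 + a)

section
variable {w : ℕ → ℝ}

lemma summable_primeWeight (hw : ∀ p : ℕ, p.Prime → 0 ≤ w p)
    (hw2 : ∀ p : ℕ, p.Prime → w p ≤ 2) {a : ℝ} (ha : 0 < a) :
    Summable fun p : Nat.Primes => w p ^ 2 / ((p : ℕ) : ℝ) ^ (1 + a) := by
  refine Summable.of_nonneg_of_le (fun p => by positivity) (fun p => ?_)
    ((summable_primes_rpow_neg (by linarith : 1 < 1 + a)).mul_left 4)
  rw [Real.rpow_neg (by positivity), ← div_eq_mul_inv]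
  have := hw p p.2
  have := hw2 p p.2
  gcongr
  nlinarith

/-- The inequality `2 w(p) ≤ 1 + w(p)²` in the exponent of the Euler product bound separates the
square of the Dirichlet series into a factor `O(1/a)` and the factor `exp (∑_p w(p)² p^(-1-a))`. -/
lemma sq_sum_prodPrimeFactors_rpow_le (hw : ∀ p : ℕ, p.Prime → 0 ≤ w p)
    (hw2 : ∀ p : ℕ, p.Prime → w p ≤ 2) {a : ℝ} (ha : 0 < a) (ha1 : a ≤ 1) (N : ℕ) :
    (a * ∑ n ∈ Ioc 0 N, prodPrimeFactors w n * (n : ℝ) ^ (-(1 + a))) ^ 2 ≤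
      10 * Real.exp primeSquareSum ^ 2 * (a * Real.exp (primeWeightSum w a)) := by
  have hs1 := summable_primes_rpow_neg (by linarith : 1 < 1 + a)
  have hs2 := summable_primeWeight hw hw2 ha
  have hE := sum_mul_rpow_le (IsMultiplicative.prodPrimeFactors w) (prodPrimeFactors_nonneg hw)
    (fun p hp k hk => prodPrimeFactors_prime_pow hp hk) hw2 (by linarith : 1 ≤ 1 + a) N
  have hS : ∑ p ∈ (N + 1).primesBelow,
      (w p * (p : ℝ) ^ (-(1 + a)) + 4 * ((p : ℝ) ^ (-(1 + a))) ^ 2) ≤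
      (1 / 2) * ∑' p : Nat.Primes, ((p : ℕ) : ℝ) ^ (-(1 + a)) + (1 / 2) * primeWeightSum w a +
        primeSquareSum := by
    rw [primeWeightSum, primeSquareSum, ← tsum_mul_left, ← tsum_mul_left,
      ← (hs1.mul_left (1 / 2)).tsum_add (hs2.mul_left (1 / 2)),
      ← ((hs1.mul_left (1 / 2)).add (hs2.mul_left (1 / 2))).tsum_add summable_primeSquare]
    refine le_trans ?_ (sum_primesBelow_le_tsum (F := fun p : ℕ => 1 / 2 * (p : ℝ) ^ (-(1 + a)) +
      1 / 2 * (w p ^ 2 / (p : ℝ) ^ (1 + a)) + 4 * (p : ℝ) ^ (-2 : ℝ)) (fun p => by positivity)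
      (((hs1.mul_left (1 / 2)).add (hs2.mul_left (1 / 2))).add summable_primeSquare) (N + 1))
    refine sum_le_sum fun p hp => ?_
    have hp := Nat.prime_of_mem_primesBelow hp
    have h1 := sq_prime_rpow_neg_le ⟨p, hp⟩ (by linarith : 1 ≤ 1 + a)
    rw [div_eq_mul_inv (w p ^ 2), ← Real.rpow_neg (by positivity)]
    have h2 : 0 ≤ (p : ℝ) ^ (-(1 + a)) := by positivity
    change ((p : ℝ) ^ (-(1 + a))) ^ 2 ≤ (p : ℝ) ^ (-2 : ℝ) at h1
    nlinarith [mul_nonneg h2 (sq_nonneg (w p - 1))]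
  have h0 : 0 ≤ ∑ n ∈ Ioc 0 N, prodPrimeFactors w n * (n : ℝ) ^ (-(1 + a)) :=
    sum_nonneg fun n _ => mul_nonneg (prodPrimeFactors_nonneg hw n) (by positivity)
  have h3 := hE.trans (Real.exp_le_exp.mpr hS)
  have h4 := exp_tsum_primes_le ha ha1
  set T := ∑' p : Nat.Primes, ((p : ℕ) : ℝ) ^ (-(1 + a))
  set S := ∑ n ∈ Ioc 0 N, prodPrimeFactors w n * (n : ℝ) ^ (-(1 + a))
  calc (a * S) ^ 2 = a ^ 2 * S ^ 2 := by ring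
    _ ≤ a ^ 2 * (Real.exp (1 / 2 * T + 1 / 2 * primeWeightSum w a + primeSquareSum)) ^ 2 := by
        gcongr
    _ = a ^ 2 * Real.exp T * (Real.exp (primeWeightSum w a) * Real.exp primeSquareSum ^ 2) := by
        rw [← Real.exp_nat_mul, ← Real.exp_nat_mul, mul_assoc, ← Real.exp_add, ← Real.exp_add]
        congr 2
        push_cast
        ring
    _ ≤ a ^ 2 * (10 / a) * (Real.exp (primeWeightSum w a) * Real.exp primeSquareSum ^ 2) := by
        gcongr
    _ = _ := by
        field_simp

end

end

/-! ### Logarithmic mass of dyadic blocks -/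

section

open ArithmeticFunction Finset Filter Topology

section LogWeight
variable {R : Type*} [Field R]

/-- The arithmetic function `n ↦ u n / n`. -/
def divId (u : ArithmeticFunction R) : ArithmeticFunction R := ⟨fun n => u n / n, by simp⟩

lemma divId_apply (u : ArithmeticFunction R) (n : ℕ) : divId u n = u n / n := rfl

lemma divId_mul (u v : ArithmeticFunction R) : divId (u * v) = divId u * divId v := by
  ext n
  rw [divId_apply, mul_apply, mul_apply, sum_div]
  refine sum_congr rfl fun x hx => ?_
  rw [← (Nat.mem_divisorsAntidiagonal.mp hx).1, divId_apply, divId_apply, Nat.cast_mul]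
  rw [mul_div_mul_comm]

/-- Logarithmic partial sums of a Dirichlet convolution. The outer sum may run past `x`, where the
inner sums are empty; this lets two values of `x` share one range. -/
lemma sum_mul_div_eq (u v : ArithmeticFunction R) {x : ℝ} {K : ℕ} (hK : ⌊x⌋₊ ≤ K) :
    ∑ n ∈ Ioc 0 ⌊x⌋₊, (u * v) n / n =
      ∑ k ∈ Ioc 0 K, u k / k * ∑ m ∈ Ioc 0 ⌊x / k⌋₊, v m / m := by
  have h := sum_Ioc_mul_eq_sum_sum (divId u) (divId v) ⌊x⌋₊
  rw [← divId_mul] at h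
  simp only [divId_apply] at h
  rw [h]
  simp_rw [Nat.floor_div_natCast]
  refine sum_subset (Ioc_subset_Ioc_right hK) fun k hk hk' => ?_
  have : ⌊x⌋₊ < k := by
    rw [mem_Ioc] at hk hk'
    omega
  rw [Nat.div_eq_of_lt this]
  simp

end LogWeight

/-- The logarithmic mass `∑_{y < n ≤ 2y} u(n) / n` of a dyadic block. -/
noncomputable def dyadicSum (u : ℕ → ℝ) (y : ℝ) : ℝ := ∑ n ∈ Ioc ⌊y⌋₊ ⌊2 * y⌋₊, u n / n

section Dyadic

lemma dyadicSum_eq_sub (u : ℕ → ℝ) {y : ℝ} (hy : 0 ≤ y) :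
    dyadicSum u y = ∑ n ∈ Ioc 0 ⌊2 * y⌋₊, u n / n - ∑ n ∈ Ioc 0 ⌊y⌋₊, u n / n := by
  have hle : ⌊y⌋₊ ≤ ⌊2 * y⌋₊ := Nat.floor_le_floor (by linarith)
  rw [dyadicSum, eq_sub_iff_add_eq, add_comm, ← sum_Ioc_consecutive _ (Nat.zero_le _) hle]

lemma dyadicSum_nonneg {u : ℕ → ℝ} (hu : ∀ n, 0 ≤ u n) (y : ℝ) : 0 ≤ dyadicSum u y :=
  sum_nonneg fun n _ => div_nonneg (hu n) (Nat.cast_nonneg n)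

lemma dyadicSum_le_sum {u : ℕ → ℝ} (hu : ∀ n, 0 ≤ u n) {y Y : ℝ} (hy : y ≤ Y) :
    dyadicSum u y ≤ ∑ n ∈ Ioc 0 ⌊2 * Y⌋₊, u n / n :=
  sum_le_sum_of_subset_of_nonneg
    (Ioc_subset_Ioc (Nat.zero_le _) (Nat.floor_le_floor (by linarith)))
    fun n _ _ => div_nonneg (hu n) (Nat.cast_nonneg n)

lemma exists_dyadicSum_le {u : ℕ → ℝ} (hu : ∀ n, 0 ≤ u n)
    (h : Tendsto (dyadicSum u) atTop (𝓝 0)) : ∃ M, ∀ y, dyadicSum u y ≤ M := by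
  obtain ⟨Y, hY⟩ := eventually_atTop.mp (h.eventually (eventually_le_nhds zero_lt_one))
  refine ⟨1 + ∑ n ∈ Ioc 0 ⌊2 * Y⌋₊, u n / n, fun y => ?_⟩
  have h0 : 0 ≤ ∑ n ∈ Ioc 0 ⌊2 * Y⌋₊, u n / n :=
    sum_nonneg fun n _ => div_nonneg (hu n) (Nat.cast_nonneg n)
  rcases le_total Y y with hy | hy
  · linarith [hY y hy]
  · linarith [dyadicSum_le_sum hu hy]

lemma dyadicSum_mul_eq_tsum (u v : ArithmeticFunction ℝ) {y : ℝ} (hy : 0 ≤ y) :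
    dyadicSum ⇑(u * v : ArithmeticFunction ℝ) y = ∑' k : ℕ, u k / k * dyadicSum v (y / k) := by
  have hle : ⌊y⌋₊ ≤ ⌊2 * y⌋₊ := Nat.floor_le_floor (by linarith)
  rw [dyadicSum_eq_sub _ hy, sum_mul_div_eq u v le_rfl, sum_mul_div_eq u v hle, ← sum_sub_distrib,
    tsum_eq_sum (s := Ioc 0 ⌊2 * y⌋₊)]
  · refine sum_congr rfl fun k _ => ?_
    rw [dyadicSum_eq_sub _ (by positivity), mul_sub, mul_div_assoc]
  · intro k hk
    rcases Nat.eq_zero_or_pos k with rfl | hk0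
    · simp
    have hlt : ⌊2 * y⌋₊ < k := by
      rw [mem_Ioc] at hk
      omega
    have hk0' : (0 : ℝ) < k := by exact_mod_cast hk0
    have h1 : 2 * (y / k) < 1 := by
      rw [← mul_div_assoc, div_lt_one hk0']
      exact (Nat.floor_lt (by positivity)).mp hlt
    rw [dyadicSum, Nat.floor_eq_zero.mpr h1, Ioc_eq_empty (by omega), sum_empty, mul_zero]

/-- Convolving with a function of finite logarithmic mass preserves the vanishing of the mass of
dyadic blocks, by dominated convergence. -/
lemma tendsto_dyadicSum_mul {u v : ArithmeticFunction ℝ} (hu : ∀ n, 0 ≤ u n) (hv : ∀ n, 0 ≤ v n)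
    (hs : Summable fun n : ℕ => u n / n) (h : Tendsto (dyadicSum v) atTop (𝓝 0)) :
    Tendsto (dyadicSum ⇑(u * v : ArithmeticFunction ℝ)) atTop (𝓝 0) := by
  obtain ⟨M, hM⟩ := exists_dyadicSum_le hv h
  have h1 : Tendsto (fun y => ∑' k : ℕ, u k / k * dyadicSum v (y / k)) atTop
      (𝓝 (∑' _ : ℕ, (0 : ℝ))) := by
    refine tendsto_tsum_of_dominated_convergence (hs.mul_right M) (fun k => ?_)
      (Eventually.of_forall fun y k => ?_)
    · rcases Nat.eq_zero_or_pos k with rfl | hk0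
      · simp
      have := h.comp (tendsto_id.atTop_div_const (by exact_mod_cast hk0 : (0 : ℝ) < k))
      simpa using this.const_mul (u k / k)
    · have h0 : 0 ≤ u k / k := div_nonneg (hu k) (Nat.cast_nonneg k)
      rw [Real.norm_of_nonneg (mul_nonneg h0 (dyadicSum_nonneg hv _))]
      exact mul_le_mul_of_nonneg_left (hM _) h0
  rw [tsum_zero] at h1
  refine h1.congr' ?_
  filter_upwards [eventually_ge_atTop 0] with y hy
  exact (dyadicSum_mul_eq_tsum u v hy).symm

end Dyadic

section Main
variable {w : ℕ → ℝ}

/-- Rankin's trick at `a = 1 / log N`. -/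
lemma tendsto_sum_prodPrimeFactors_div_log (hw : ∀ p : ℕ, p.Prime → 0 ≤ w p)
    (hw2 : ∀ p : ℕ, p.Prime → w p ≤ 2)
    (H : Tendsto (fun a => a * Real.exp (primeWeightSum w a)) (𝓝[>] 0) (𝓝 0)) :
    Tendsto (fun N : ℕ => (∑ n ∈ Ioc 0 N, prodPrimeFactors w n / n) / Real.log N) atTop (𝓝 0) := by
  set C := 10 * Real.exp primeSquareSum ^ 2 with hC
  have hlog : Tendsto (fun N : ℕ => Real.log N) atTop atTop :=
    Real.tendsto_log_atTop.comp tendsto_natCast_atTop_atTop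
  have ha : Tendsto (fun N : ℕ => (Real.log N)⁻¹) atTop (𝓝[>] 0) :=
    tendsto_inv_atTop_nhdsGT_zero.comp hlog
  have h1 : Tendsto (fun N : ℕ => Real.exp 1 * √(C * ((Real.log N)⁻¹ *
      Real.exp (primeWeightSum w (Real.log N)⁻¹)))) atTop (𝓝 0) := by
    have := (((H.comp ha).const_mul C).sqrt).const_mul (Real.exp 1)
    simpa using! this
  refine squeeze_zero' ?_ ?_ h1
  · filter_upwards with N
    exact div_nonneg (sum_nonneg fun n _ => div_nonneg (prodPrimeFactors_nonneg hw n)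
      (Nat.cast_nonneg n)) (Real.log_natCast_nonneg N)
  · filter_upwards [hlog.eventually_ge_atTop 1] with N hN
    have hN0 : 0 < N := by
      rcases Nat.eq_zero_or_pos N with rfl | h
      · simp at hN; linarith
      · exact h
    have hN' : (0 : ℝ) < N := by exact_mod_cast hN0
    set a := (Real.log N)⁻¹ with ha
    have ha0 : 0 < a := by positivity
    have ha1 : a ≤ 1 := inv_le_one_of_one_le₀ hN
    have hsq := sq_sum_prodPrimeFactors_rpow_le hw hw2 ha0 ha1 N
    have hle := Real.le_sqrt_of_sq_le hsq
    rw [div_eq_mul_inv, mul_comm, ← ha]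
    calc a * ∑ n ∈ Ioc 0 N, prodPrimeFactors w n / n
        ≤ a * ∑ n ∈ Ioc 0 N, Real.exp 1 * (prodPrimeFactors w n * (n : ℝ) ^ (-(1 + a))) := by
          gcongr with n hn
          rw [mem_Ioc] at hn
          have hn0 : (0 : ℝ) < n := by exact_mod_cast hn.1
          have hnN : (n : ℝ) ≤ N := by exact_mod_cast hn.2
          -- `n ^ a ≤ N ^ a = e` for the choice `a = 1 / log N`
          have h2 : (n : ℝ) ^ a ≤ Real.exp 1 := by
            calc (n : ℝ) ^ a ≤ (N : ℝ) ^ a := Real.rpow_le_rpow hn0.le hnN ha0.le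
              _ = Real.exp 1 := by
                rw [Real.rpow_def_of_pos hN', ha, mul_inv_cancel₀ (by linarith)]
          have h3 : (n : ℝ)⁻¹ = (n : ℝ) ^ a * (n : ℝ) ^ (-(1 + a)) := by
            rw [← Real.rpow_add hn0, ← Real.rpow_neg_one]
            ring_nf
          have h4 : 0 ≤ prodPrimeFactors w n * (n : ℝ) ^ (-(1 + a)) :=
            mul_nonneg (prodPrimeFactors_nonneg hw n) (by positivity)
          rw [div_eq_mul_inv, h3]
          calc _ = (n : ℝ) ^ a * (prodPrimeFactors w n * (n : ℝ) ^ (-(1 + a))) := by ring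
            _ ≤ _ := mul_le_mul_of_nonneg_right h2 h4
      _ = Real.exp 1 * (a * ∑ n ∈ Ioc 0 N, prodPrimeFactors w n * (n : ℝ) ^ (-(1 + a))) := by
          rw [← mul_sum]; ring
      _ ≤ _ := by gcongr

/-- On a dyadic block `log n` is of the size of `log y`, so the gain of a logarithm in
`sum_prodPrimeFactors_mul_log_le` turns `o(log y)` into `o(1)`. -/
lemma tendsto_dyadicSum_prodPrimeFactors (hw : ∀ p : ℕ, p.Prime → 0 ≤ w p)
    (hw2 : ∀ p : ℕ, p.Prime → w p ≤ 2)
    (H : Tendsto (fun a => a * Real.exp (primeWeightSum w a)) (𝓝[>] 0) (𝓝 0)) :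
    Tendsto (dyadicSum (prodPrimeFactors w)) atTop (𝓝 0) := by
  have hg := prodPrimeFactors_nonneg hw
  have hfl : Tendsto (fun y : ℝ => ⌊2 * y⌋₊) atTop atTop :=
    tendsto_nat_floor_atTop.comp (tendsto_id.const_mul_atTop two_pos)
  have h1 := ((tendsto_sum_prodPrimeFactors_div_log hw hw2 H).comp hfl).const_mul
    (8 * (Real.log 4 + 4))
  rw [mul_zero] at h1
  refine squeeze_zero' (Eventually.of_forall fun y => dyadicSum_nonneg hg y) ?_ h1
  filter_upwards [eventually_ge_atTop 2] with y hy
  have hlogy : 0 < Real.log y := Real.log_pos (by linarith)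
  set N := ⌊2 * y⌋₊ with hN
  have hN1 : (N : ℝ) ≤ 2 * y := Nat.floor_le (by linarith)
  have hN2 : (4 : ℝ) ≤ N := by
    have : 4 ≤ N := Nat.le_floor (by push_cast; linarith)
    exact_mod_cast this
  have hlogN : 0 < Real.log N := Real.log_pos (by linarith)
  have hlogN2 : Real.log N ≤ 2 * Real.log y := by
    have := Real.log_le_log (by linarith) (hN1.trans (by nlinarith : 2 * y ≤ y ^ 2))
    rwa [Real.log_pow] at this
  have h2 : dyadicSum (prodPrimeFactors w) y ≤
      (∑ n ∈ Ioc 0 N, prodPrimeFactors w n * Real.log n) / (y * Real.log y) := by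
    rw [sum_div]
    calc dyadicSum (prodPrimeFactors w) y ≤ ∑ n ∈ Ioc ⌊y⌋₊ N,
          prodPrimeFactors w n * Real.log n / (y * Real.log y) := by
          refine sum_le_sum fun n hn => ?_
          have hn1 : y < n := (Nat.floor_lt (by linarith)).mp (mem_Ioc.mp hn).1
          rw [div_le_div_iff₀ (by linarith) (by positivity), mul_assoc]
          refine mul_le_mul_of_nonneg_left ?_ (hg n)
          rw [mul_comm]
          have := Real.log_le_log (by linarith) hn1.le
          gcongr
      _ ≤ _ := sum_le_sum_of_subset_of_nonneg (Ioc_subset_Ioc_left (Nat.zero_le _))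
          fun n _ _ => div_nonneg (mul_nonneg (hg n) (Real.log_natCast_nonneg n)) (by positivity)
  refine h2.trans ?_
  have h3 := sum_prodPrimeFactors_mul_log_le hw hw2 N
  have hΓ : 0 ≤ ∑ n ∈ Ioc 0 N, prodPrimeFactors w n / n :=
    sum_nonneg fun n _ => div_nonneg (hg n) (Nat.cast_nonneg n)
  have hK : 0 ≤ Real.log 4 + 4 := by positivity
  simp only [Function.comp_apply]
  rw [← hN]
  set Γ := ∑ n ∈ Ioc 0 N, prodPrimeFactors w n / n
  rw [div_le_iff₀ (by positivity)]
  refine h3.trans ?_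
  calc 2 * (Real.log 4 + 4) * N * Γ ≤ 2 * (Real.log 4 + 4) * (2 * y) * Γ := by gcongr
    _ = 4 * (Real.log 4 + 4) * (Γ / Real.log N) * (y * Real.log N) := by field_simp; ring
    _ ≤ 4 * (Real.log 4 + 4) * (Γ / Real.log N) * (y * (2 * Real.log y)) := by gcongr
    _ = _ := by ring

end Main

end

/-! ### Majorizing the convolution of a multiplicative function with `1` -/

section

open ArithmeticFunction Finset Filter Topology

/-- The indicator function of the positive perfect squares. -/
noncomputable def squareIndicator : ArithmeticFunction ℝ :=
  ⟨fun n => open Classical in if n ≠ 0 ∧ IsSquare n then 1 else 0, by simp⟩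

lemma squareIndicator_apply (n : ℕ) :
    squareIndicator n = open Classical in if n ≠ 0 ∧ IsSquare n then 1 else 0 := rfl

lemma squareIndicator_nonneg (n : ℕ) : 0 ≤ squareIndicator n := by
  rw [squareIndicator_apply]
  split_ifs <;> norm_num

lemma isSquare_of_coprime_mul {m n : ℕ} (h : m.Coprime n) (hs : IsSquare (m * n)) : IsSquare m := by
  obtain ⟨c, hc⟩ := hs
  obtain ⟨d, hd⟩ := exists_eq_pow_of_mul_eq_pow (Nat.isUnit_iff.mpr h) (hc.trans (sq c).symm)
  exact ⟨d, hd.trans (sq d)⟩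

lemma isMultiplicative_squareIndicator : squareIndicator.IsMultiplicative := by
  rw [IsMultiplicative.iff_ne_zero]
  refine ⟨by simp [squareIndicator_apply], fun {m n} hm hn h => ?_⟩
  have hiff : IsSquare (m * n) ↔ IsSquare m ∧ IsSquare n :=
    ⟨fun hs => ⟨isSquare_of_coprime_mul h hs,
      isSquare_of_coprime_mul h.symm (by rwa [mul_comm])⟩, fun hs => hs.1.mul hs.2⟩
  by_cases h1 : IsSquare m <;> by_cases h2 : IsSquare n <;>
    simp [squareIndicator_apply, hm, hn, hiff, h1, h2]

lemma summable_squareIndicator_div : Summable fun n : ℕ => squareIndicator n / n := by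
  have hinj : Function.Injective fun k : ℕ => k ^ 2 := fun a b h => by simpa using h
  rw [← hinj.summable_iff]
  · refine Summable.of_nonneg_of_le (fun k => ?_) (fun k => ?_)
      (Real.summable_one_div_nat_pow.mpr one_lt_two)
    · exact div_nonneg (squareIndicator_nonneg _) (Nat.cast_nonneg _)
    · simp only [Function.comp_apply, Nat.cast_pow]
      gcongr
      rw [squareIndicator_apply]
      split_ifs <;> norm_num
  · intro n hn
    have : ¬ IsSquare n := by
      rintro ⟨k, rfl⟩
      exact hn ⟨k, by simp [sq]⟩
    simp [squareIndicator_apply, this]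

lemma squareIndicator_prime_pow_add_two {p : ℕ} (hp : p.Prime) (j : ℕ) :
    squareIndicator (p ^ (j + 2)) = squareIndicator (p ^ j) := by
  have : IsSquare (p ^ (j + 2)) ↔ IsSquare (p ^ j) := by
    constructor
    · rintro ⟨c, hc⟩
      have hpc : p ∣ c := by
        have : p ∣ c * c := hc ▸ dvd_pow_self p (by omega)
        exact (hp.dvd_mul.mp this).elim id id
      obtain ⟨d, rfl⟩ := hpc
      refine ⟨d, ?_⟩
      have hp2 : 0 < p ^ 2 := pow_pos hp.pos 2
      apply Nat.eq_of_mul_eq_mul_left hp2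
      calc p ^ 2 * p ^ j = p ^ (j + 2) := by ring
        _ = _ := by rw [hc]; ring
    · rintro ⟨c, hc⟩
      exact ⟨p * c, by rw [pow_add, hc]; ring⟩
  simp [squareIndicator_apply, hp.ne_zero, this]

lemma squareIndicator_prime {p : ℕ} (hp : p.Prime) : squareIndicator p = 0 := by
  have : ¬ IsSquare p := hp.prime.not_isSquare
  simp [squareIndicator_apply, this]

lemma mul_prime_pow_apply {R : Type*} [CommSemiring R] (u v : ArithmeticFunction R) {p : ℕ}
    (hp : p.Prime) (k : ℕ) :
    (u * v) (p ^ k) = ∑ j ∈ range (k + 1), u (p ^ j) * v (p ^ (k - j)) := by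
  rw [mul_apply, Nat.sum_divisorsAntidiagonal (f := fun a b => u a * v b),
    Nat.sum_divisors_prime_pow hp]
  refine sum_congr rfl fun j hj => ?_
  rw [Nat.pow_div (by simpa [Nat.lt_succ_iff] using hj) hp.pos]

lemma squareIndicator_mul_prime_pow_add_two (g : ArithmeticFunction ℝ) {p : ℕ} (hp : p.Prime)
    (k : ℕ) : (squareIndicator * g) (p ^ (k + 2)) =
      (squareIndicator * g) (p ^ k) + g (p ^ (k + 2)) := by
  rw [mul_prime_pow_apply _ _ hp, mul_prime_pow_apply _ _ hp, sum_range_succ', sum_range_succ']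
  simp only [squareIndicator_prime_pow_add_two hp, zero_add, pow_one, squareIndicator_prime hp,
    zero_mul, add_zero, pow_zero, isMultiplicative_squareIndicator.1, one_mul, Nat.sub_zero]
  congr 1
  refine sum_congr rfl fun j hj => ?_
  congr 3
  omega

section
variable {f : ℕ → ℂ}

/-- The function `f` on the positive integers as an arithmetic function; the value `f 0` is replaced
by `0`. -/
noncomputable def positivePart (f : ℕ → ℂ) : ArithmeticFunction ℂ :=
  ⟨fun n => if n = 0 then 0 else f n, by simp⟩

lemma positivePart_apply {n : ℕ} (hn : n ≠ 0) : positivePart f n = f n := if_neg hn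

lemma isMultiplicative_positivePart (hf : IsCM f) (h1 : f 1 = 1) :
    (positivePart f).IsMultiplicative := by
  rw [IsMultiplicative.iff_ne_zero]
  refine ⟨by rw [positivePart_apply one_ne_zero, h1], fun {m n} hm hn _ => ?_⟩
  rw [positivePart_apply hm, positivePart_apply hn, positivePart_apply (mul_ne_zero hm hn)]
  exact hf m n (Nat.one_le_iff_ne_zero.mpr hm) (Nat.one_le_iff_ne_zero.mpr hn)

lemma IsCM.map_prime_pow (hf : IsCM f) (h1 : f 1 = 1) {p : ℕ} (hp : p.Prime) (k : ℕ) :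
    f (p ^ k) = f p ^ k := by
  induction k with
  | zero => simpa using h1
  | succ k ih => rw [pow_succ, hf _ _ (Nat.one_le_pow _ _ hp.pos) hp.pos, ih, pow_succ]

lemma IsCM.norm_le_one (hf : IsCM f) (h1 : f 1 = 1) (hb : ∀ p : ℕ, p.Prime → ‖f p‖ ≤ 1) {n : ℕ}
    (hn : n ≠ 0) : ‖f n‖ ≤ 1 := by
  induction n using Nat.recOnMul with
  | zero => exact absurd rfl hn
  | one => simp [h1]
  | prime p hp => exact hb p hp
  | mul a b ha hb' =>
    have ha0 : a ≠ 0 := left_ne_zero_of_mul hn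
    have hb0 : b ≠ 0 := right_ne_zero_of_mul hn
    rw [hf a b (Nat.one_le_iff_ne_zero.mpr ha0) (Nat.one_le_iff_ne_zero.mpr hb0), norm_mul]
    exact mul_le_one₀ (ha ha0) (norm_nonneg _) (hb' hb0)

/-- On prime powers, `(f * 1)(p^k) = 1 + f(p) + ⋯ + f(p)^k`, and adding two more terms adds
`f(p)^(k+1) (1 + f(p))`. The right side satisfies the same recurrence with increment
`|1 + f(p)|`. -/
lemma norm_positivePart_mul_zeta_prime_pow_le (hf : IsCM f) (h1 : f 1 = 1)
    (hb : ∀ p : ℕ, p.Prime → ‖f p‖ ≤ 1) {p : ℕ} (hp : p.Prime) (k : ℕ) :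
    ‖(positivePart f * (zeta : ArithmeticFunction ℂ)) (p ^ k)‖ ≤
      (squareIndicator * prodPrimeFactors fun q => ‖1 + f q‖) (p ^ k) := by
  have hS : ∀ k, (positivePart f * (zeta : ArithmeticFunction ℂ)) (p ^ k) =
      ∑ j ∈ range (k + 1), f p ^ j := by
    intro k
    rw [mul_prime_pow_apply _ _ hp]
    refine sum_congr rfl fun j _ => ?_
    rw [positivePart_apply (pow_ne_zero _ hp.ne_zero), hf.map_prime_pow h1 hp,
      natCoe_apply, zeta_apply_ne (pow_ne_zero _ hp.ne_zero)]
    simp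
  induction k using Nat.twoStepInduction with
  | zero =>
    simp [positivePart_apply, h1, isMultiplicative_squareIndicator.1,
      (IsMultiplicative.prodPrimeFactors _).1]
  | one =>
    rw [hS, mul_prime_pow_apply _ _ hp]
    simp only [sum_range_succ, range_one, sum_singleton, pow_zero, pow_one,
      isMultiplicative_squareIndicator.1, squareIndicator_prime hp, zero_mul, add_zero, one_mul,
      Nat.sub_zero]
    have := prodPrimeFactors_prime_pow (w := fun q => ‖1 + f q‖) hp one_ne_zero
    rw [pow_one] at this
    rw [this]
  | more k ih _ =>
    rw [squareIndicator_mul_prime_pow_add_two _ hp, prodPrimeFactors_prime_pow hp (by omega)]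
    have e : (positivePart f * (zeta : ArithmeticFunction ℂ)) (p ^ (k + 2)) =
        (positivePart f * (zeta : ArithmeticFunction ℂ)) (p ^ k) + f p ^ (k + 1) * (1 + f p) := by
      rw [hS, hS, sum_range_succ, sum_range_succ]
      ring
    rw [e]
    refine (norm_add_le _ _).trans (add_le_add ih ?_)
    rw [norm_mul, norm_pow]
    exact mul_le_of_le_one_left (norm_nonneg _) (pow_le_one₀ (norm_nonneg _) (hb p hp))

lemma norm_positivePart_mul_zeta_le (hf : IsCM f) (h1 : f 1 = 1)
    (hb : ∀ p : ℕ, p.Prime → ‖f p‖ ≤ 1) (n : ℕ) :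
    ‖(positivePart f * (zeta : ArithmeticFunction ℂ)) n‖ ≤
      (squareIndicator * prodPrimeFactors fun q => ‖1 + f q‖) n := by
  rcases eq_or_ne n 0 with rfl | hn
  · simp
  have m1 : (positivePart f * (zeta : ArithmeticFunction ℂ)).IsMultiplicative :=
    (isMultiplicative_positivePart hf h1).mul isMultiplicative_zeta.natCast
  have m2 := isMultiplicative_squareIndicator.mul
    (IsMultiplicative.prodPrimeFactors fun q => ‖1 + f q‖)
  rw [m1.multiplicative_factorization _ hn, m2.multiplicative_factorization _ hn, Finsupp.prod,
    Finsupp.prod, norm_prod]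
  refine prod_le_prod (fun p _ => norm_nonneg _) fun p hp => ?_
  exact norm_positivePart_mul_zeta_prime_pow_le hf h1 hb (Nat.prime_of_mem_primeFactors hp) _

end

end

/-! ### Means over short windows, and slow variation -/

section

open Finset Filter Topology MeasureTheory

lemma measurable_dyadicSum (c : ℕ → ℝ) : Measurable (dyadicSum c) := by
  have h : Measurable fun p : ℕ × ℕ => ∑ n ∈ Ioc p.1 p.2, c n / n := Measurable.of_discrete
  exact h.comp (Nat.measurable_floor.prodMk
    (Nat.measurable_floor.comp (measurable_id.const_mul (2 : ℝ))))

/-- A translate by `log d` falls into a window of length `log 2` exactly when `d` lies in a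
dyadic block. -/
lemma add_log_mem_Ioc_iff {v w : ℝ} {d : ℕ} (hd : 0 < d) :
    w + Real.log d ∈ Set.Ioc v (v + Real.log 2) ↔
      d ∈ Ioc ⌊Real.exp (v - w)⌋₊ ⌊2 * Real.exp (v - w)⌋₊ := by
  have hd0 : (0 : ℝ) < d := by exact_mod_cast hd
  have h1 : v < w + Real.log d ↔ Real.exp (v - w) < d := by
    rw [← Real.lt_log_iff_exp_lt hd0]
    constructor <;> intro h <;> linarith
  have h2 : w + Real.log d ≤ v + Real.log 2 ↔ (d : ℝ) ≤ 2 * Real.exp (v - w) := by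
    have e : 2 * Real.exp (v - w) = Real.exp (Real.log 2 + (v - w)) := by
      rw [Real.exp_add, Real.exp_log two_pos]
    rw [e, ← Real.log_le_iff_le_exp hd0]
    constructor <;> intro h <;> linarith
  rw [Set.mem_Ioc, mem_Ioc, Nat.floor_lt (Real.exp_pos _).le, Nat.le_floor_iff (by positivity), h1,
    h2]

section
variable {c : ℕ → ℝ} {q s : ℝ → ℂ}

/-- Integrating over a window of length `log 2` and exchanging sum and integral gathers the
coefficients `c d / d` of a dyadic block. -/
lemma setIntegral_norm_le (hc : ∀ n, 0 ≤ c n) (hq : Integrable q) {M : ℝ}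
    (hM : ∀ y, dyadicSum c y ≤ M)
    (hs : ∀ w, ‖s w‖ ≤ ∑ d ∈ Ioc 0 ⌊Real.exp w⌋₊, c d / d * ‖q (w - Real.log d)‖) (v : ℝ) :
    ∫ w in Set.Ioc v (v + Real.log 2), ‖s w‖ ≤
      ∫ w, ‖q w‖ * dyadicSum c (Real.exp (v - w)) := by
  set D := ⌊Real.exp (v + Real.log 2)⌋₊ with hD
  have hcd : ∀ d : ℕ, 0 ≤ c d / d := fun d => div_nonneg (hc d) (Nat.cast_nonneg d)
  have hqi : ∀ d : ℕ, Integrable fun w => ‖q (w - Real.log d)‖ :=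
    fun d => (hq.comp_sub_right _).norm
  have htrans : ∀ d : ℕ, ∫ w in Set.Ioc v (v + Real.log 2), ‖q (w - Real.log d)‖ =
      ∫ w, (Set.Ioc v (v + Real.log 2)).indicator (fun _ => ‖q w‖) (w + Real.log d) := by
    intro d
    rw [← integral_indicator measurableSet_Ioc,
      ← integral_add_right_eq_self _ (Real.log d)]
    congr 1
    ext w
    simp only [Set.indicator, add_sub_cancel_right]
  have hind : ∀ d : ℕ, Integrable fun w =>
      (Set.Ioc v (v + Real.log 2)).indicator (fun _ => ‖q w‖) (w + Real.log d) := by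
    intro d
    have : (fun w => (Set.Ioc v (v + Real.log 2)).indicator (fun _ => ‖q w‖) (w + Real.log d)) =
        ((fun w => w + Real.log d) ⁻¹' (Set.Ioc v (v + Real.log 2))).indicator fun w => ‖q w‖ := by
      ext w
      simp only [Set.indicator, Set.mem_preimage]
    rw [this]
    exact hq.norm.indicator ((measurable_add_const _) measurableSet_Ioc)
  calc ∫ w in Set.Ioc v (v + Real.log 2), ‖s w‖
      ≤ ∫ w in Set.Ioc v (v + Real.log 2), ∑ d ∈ Ioc 0 D, c d / d * ‖q (w - Real.log d)‖ := by
        refine integral_mono_of_nonneg (Eventually.of_forall fun w => norm_nonneg _)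
          (integrable_finsetSum _ fun d _ => ((hqi d).const_mul _).integrableOn) ?_
        filter_upwards [ae_restrict_mem measurableSet_Ioc] with w hw
        refine (hs w).trans (sum_le_sum_of_subset_of_nonneg (Ioc_subset_Ioc_right ?_)
          fun d _ _ => mul_nonneg (hcd d) (norm_nonneg _))
        exact Nat.floor_le_floor (Real.exp_le_exp.mpr hw.2)
    _ = ∑ d ∈ Ioc 0 D, ∫ w, c d / d *
          (Set.Ioc v (v + Real.log 2)).indicator (fun _ => ‖q w‖) (w + Real.log d) := by
        rw [integral_finsetSum _ fun d _ => ((hqi d).const_mul _).integrableOn]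
        refine sum_congr rfl fun d _ => ?_
        rw [integral_const_mul, integral_const_mul, htrans]
    _ = ∫ w, ∑ d ∈ Ioc 0 D, c d / d *
          (Set.Ioc v (v + Real.log 2)).indicator (fun _ => ‖q w‖) (w + Real.log d) :=
        (integral_finsetSum _ fun d _ => (hind d).const_mul _).symm
    _ ≤ _ := by
        refine integral_mono_of_nonneg (Eventually.of_forall fun w => sum_nonneg fun d _ =>
          mul_nonneg (hcd d) (Set.indicator_nonneg (fun _ _ => norm_nonneg _) _)) ?_
          (Eventually.of_forall fun w => ?_)
        · refine (hq.norm.mul_const M).mono' ?_ (Eventually.of_forall fun w => ?_)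
          · exact hq.norm.aestronglyMeasurable.mul ((measurable_dyadicSum c).comp
              (Real.measurable_exp.comp (measurable_const.sub measurable_id))).aestronglyMeasurable
          · rw [Real.norm_of_nonneg (mul_nonneg (norm_nonneg _) (dyadicSum_nonneg hc _))]
            exact mul_le_mul_of_nonneg_left (hM _) (norm_nonneg _)
        · simp only
          rw [dyadicSum, mul_sum]
          have e : ∀ d ∈ Ioc 0 D, c d / d *
              (Set.Ioc v (v + Real.log 2)).indicator (fun _ => ‖q w‖) (w + Real.log d) =
              if d ∈ Ioc ⌊Real.exp (v - w)⌋₊ ⌊2 * Real.exp (v - w)⌋₊ then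
                ‖q w‖ * (c d / d) else 0 := by
            intro d hd
            have := add_log_mem_Ioc_iff (v := v) (w := w) (mem_Ioc.mp hd).1
            rw [Set.indicator_apply]
            simp only [this]
            split_ifs
            · ring
            · ring
          rw [sum_congr rfl e, ← sum_filter]
          refine sum_le_sum_of_subset_of_nonneg (fun d hd => (mem_filter.mp hd).2)
            fun d _ _ => mul_nonneg (norm_nonneg _) (hcd d)

/-- An integrable kernel averages the vanishing dyadic masses to `0`, by dominated convergence. -/
lemma tendsto_setIntegral_norm (hc : ∀ n, 0 ≤ c n) (hq : Integrable q)
    (h : Tendsto (dyadicSum c) atTop (𝓝 0))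
    (hs : ∀ w, ‖s w‖ ≤ ∑ d ∈ Ioc 0 ⌊Real.exp w⌋₊, c d / d * ‖q (w - Real.log d)‖) :
    Tendsto (fun v => ∫ w in Set.Ioc v (v + Real.log 2), ‖s w‖) atTop (𝓝 0) := by
  obtain ⟨M, hM⟩ := exists_dyadicSum_le hc h
  have h1 : Tendsto (fun v => ∫ w, ‖q w‖ * dyadicSum c (Real.exp (v - w))) atTop
      (𝓝 (∫ _ : ℝ, (0 : ℝ))) := by
    refine tendsto_integral_filter_of_dominated_convergence (fun w => ‖q w‖ * M)
      (Eventually.of_forall fun v => ?_) (Eventually.of_forall fun v => Eventually.of_forall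
        fun w => ?_) (hq.norm.mul_const M) (Eventually.of_forall fun w => ?_)
    · exact hq.norm.aestronglyMeasurable.mul ((measurable_dyadicSum c).comp
        (Real.measurable_exp.comp (measurable_const.sub measurable_id))).aestronglyMeasurable
    · rw [Real.norm_of_nonneg (mul_nonneg (norm_nonneg _) (dyadicSum_nonneg hc _))]
      exact mul_le_mul_of_nonneg_left (hM _) (norm_nonneg _)
    · have h2 : Tendsto (fun v => Real.exp (v - w)) atTop atTop :=
        Real.tendsto_exp_atTop.comp (tendsto_atTop_add_const_right _ _ tendsto_id)
      simpa using! (h.comp h2).const_mul ‖q w‖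
  rw [integral_zero] at h1
  exact squeeze_zero (fun v => integral_nonneg fun w => norm_nonneg _)
    (setIntegral_norm_le hc hq hM hs) h1

end

/-- Partial sums with terms of size at most `1/n` vary slowly on the logarithmic scale, so that they
tend to `0` as soon as their means over windows of length `log 2` do. -/
lemma tendsto_sum_of_tendsto_setIntegral {a : ℕ → ℂ} (ha : ∀ n : ℕ, ‖a n‖ ≤ (n : ℝ)⁻¹)
    (h : Tendsto (fun v => ∫ w in Set.Ioc v (v + Real.log 2),
      ‖∑ n ∈ Ioc 0 ⌊Real.exp w⌋₊, a n‖) atTop (𝓝 0)) :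
    Tendsto (fun N : ℕ => ∑ n ∈ Ioc 0 N, a n) atTop (𝓝 0) := by
  set S : ℝ → ℂ := fun w => ∑ n ∈ Ioc 0 ⌊Real.exp w⌋₊, a n with hS
  have hSm : Measurable S := (measurable_from_nat (f := fun N => ∑ n ∈ Ioc 0 N, a n)).comp
    (Nat.measurable_floor.comp Real.measurable_exp)
  have hint : ∀ v, IntegrableOn (fun w => ‖S w‖) (Set.Ioc v (v + Real.log 2)) := by
    intro v
    refine Measure.integrableOn_of_bounded (M := Real.exp (v + Real.log 2)) (by simp)
      hSm.norm.aestronglyMeasurable ?_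
    filter_upwards [ae_restrict_mem measurableSet_Ioc] with w hw
    rw [norm_norm]
    calc ‖S w‖ ≤ ∑ n ∈ Ioc 0 ⌊Real.exp w⌋₊, (1 : ℝ) := by
          refine norm_sum_le_of_le _ fun n hn => (ha n).trans ?_
          exact inv_le_one_of_one_le₀ (by exact_mod_cast (mem_Ioc.mp hn).1)
      _ = ⌊Real.exp w⌋₊ := by simp
      _ ≤ Real.exp w := Nat.floor_le (Real.exp_pos _).le
      _ ≤ _ := Real.exp_le_exp.mpr hw.2
  -- the partial sums vary slowly on the logarithmic scale
  have key : ∀ δ : ℝ, 0 < δ → δ ≤ Real.log 2 → ∀ N : ℕ, 0 < N →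
      ‖∑ n ∈ Ioc 0 N, a n‖ ≤
        (∫ w in Set.Ioc (Real.log N) (Real.log N + Real.log 2), ‖S w‖) / δ + (Real.exp δ - 1) := by
    intro δ hδ hδ2 N hN
    have hN0 : (0 : ℝ) < N := by exact_mod_cast hN
    have hpt : ∀ w ∈ Set.Ioc (Real.log N) (Real.log N + δ),
        ‖∑ n ∈ Ioc 0 N, a n‖ - (Real.exp δ - 1) ≤ ‖S w‖ := by
      intro w hw
      have hle : N ≤ ⌊Real.exp w⌋₊ := by
        refine Nat.le_floor ?_
        rw [← Real.log_le_iff_le_exp hN0]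
        exact hw.1.le
      have hsplit : S w = ∑ n ∈ Ioc 0 N, a n + ∑ n ∈ Ioc N ⌊Real.exp w⌋₊, a n :=
        (sum_Ioc_consecutive _ (Nat.zero_le _) hle).symm
      have hrest : ‖∑ n ∈ Ioc N ⌊Real.exp w⌋₊, a n‖ ≤ Real.exp δ - 1 := by
        calc _ ≤ ∑ n ∈ Ioc N ⌊Real.exp w⌋₊, (N : ℝ)⁻¹ := by
              refine norm_sum_le_of_le _ fun n hn => (ha n).trans ?_
              exact inv_anti₀ hN0 (by exact_mod_cast (mem_Ioc.mp hn).1.le)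
          _ = ((⌊Real.exp w⌋₊ : ℝ) - N) * (N : ℝ)⁻¹ := by
              rw [sum_const, Nat.card_Ioc, nsmul_eq_mul, Nat.cast_sub hle]
          _ ≤ (N * Real.exp δ - N) * (N : ℝ)⁻¹ := by
              gcongr
              refine (Nat.floor_le (Real.exp_pos _).le).trans ?_
              rw [← Real.exp_log hN0, ← Real.exp_add]
              exact Real.exp_le_exp.mpr hw.2
          _ = Real.exp δ - 1 := by field_simp
      have : ‖∑ n ∈ Ioc 0 N, a n‖ ≤ ‖S w‖ + ‖∑ n ∈ Ioc N ⌊Real.exp w⌋₊, a n‖ := by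
        rw [hsplit]
        simpa using norm_sub_le (∑ n ∈ Ioc 0 N, a n + ∑ n ∈ Ioc N ⌊Real.exp w⌋₊, a n)
          (∑ n ∈ Ioc N ⌊Real.exp w⌋₊, a n)
      linarith
    have hsub : Set.Ioc (Real.log N) (Real.log N + δ) ⊆
        Set.Ioc (Real.log N) (Real.log N + Real.log 2) := Set.Ioc_subset_Ioc_right (by linarith)
    have h1 : ∫ w in Set.Ioc (Real.log N) (Real.log N + δ),
        (‖∑ n ∈ Ioc 0 N, a n‖ - (Real.exp δ - 1)) ≤
        ∫ w in Set.Ioc (Real.log N) (Real.log N + δ), ‖S w‖ :=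
      setIntegral_mono_on (integrableOn_const (by simp)) ((hint _).mono_set hsub)
        measurableSet_Ioc hpt
    have h2 : ∫ w in Set.Ioc (Real.log N) (Real.log N + δ), ‖S w‖ ≤
        ∫ w in Set.Ioc (Real.log N) (Real.log N + Real.log 2), ‖S w‖ :=
      setIntegral_mono_set (hint _) (Eventually.of_forall fun w => norm_nonneg _)
        hsub.eventuallyLE
    rw [setIntegral_const, Real.volume_real_Ioc_of_le (by linarith), add_sub_cancel_left,
      smul_eq_mul] at h1
    rw [← sub_le_iff_le_add, le_div_iff₀ hδ, mul_comm]
    exact h1.trans h2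
  rw [Metric.tendsto_atTop]
  intro ε hε
  have hδ : ∃ δ : ℝ, 0 < δ ∧ δ ≤ Real.log 2 ∧ Real.exp δ - 1 ≤ ε / 2 := by
    refine ⟨min (Real.log 2) (Real.log (1 + ε / 2)), lt_min (Real.log_pos one_lt_two)
      (Real.log_pos (by linarith)), min_le_left _ _, ?_⟩
    have := Real.exp_le_exp.mpr (min_le_right (Real.log 2) (Real.log (1 + ε / 2)))
    rw [Real.exp_log (by linarith)] at this
    linarith
  obtain ⟨δ, hδ0, hδ2, hδε⟩ := hδ
  have hlim := ((h.comp (Real.tendsto_log_atTop.comp tendsto_natCast_atTop_atTop)).div_const δ)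
  rw [zero_div] at hlim
  obtain ⟨N₀, hN₀⟩ := eventually_atTop.mp (hlim.eventually (gt_mem_nhds (half_pos hε)))
  refine ⟨max N₀ 1, fun N hN => ?_⟩
  have h3 := hN₀ N (le_of_max_le_left hN)
  have h4 := key δ hδ0 hδ2 N (le_of_max_le_right hN)
  simp only [Function.comp_apply] at h3
  rw [dist_zero_right]
  linarith

end

/-! ### The case of a slowly growing weighted prime sum -/

section

open ArithmeticFunction Finset Filter Topology MeasureTheory

/-- The identity `f = (f * 1) * μ` on the level of logarithmic partial sums. -/
lemma sum_div_eq_sum_mul_moebiusMean (f : ℕ → ℂ) (w : ℝ) :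
    ∑ n ∈ Ioc 0 ⌊Real.exp w⌋₊, f n / n =
      ∑ d ∈ Ioc 0 ⌊Real.exp w⌋₊, (positivePart f * (zeta : ArithmeticFunction ℂ)) d / d *
        moebiusMean (Real.exp (w - Real.log d)) := by
  have h : positivePart f =
      (positivePart f * (zeta : ArithmeticFunction ℂ)) * (moebius : ArithmeticFunction ℂ) := by
    rw [mul_assoc, coe_zeta_mul_coe_moebius, mul_one]
  have h2 := sum_mul_div_eq (positivePart f * (zeta : ArithmeticFunction ℂ))
    (moebius : ArithmeticFunction ℂ) (le_refl ⌊Real.exp w⌋₊)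
  rw [← h] at h2
  calc _ = ∑ n ∈ Ioc 0 ⌊Real.exp w⌋₊, positivePart f n / n := by
        refine sum_congr rfl fun n hn => ?_
        rw [positivePart_apply (mem_Ioc.mp hn).1.ne']
    _ = _ := by
        rw [h2]
        refine sum_congr rfl fun d hd => ?_
        have hd0 : (0 : ℝ) < d := by exact_mod_cast (mem_Ioc.mp hd).1
        rw [moebiusMean, Real.exp_sub, Real.exp_log hd0]
        rfl

/-- The averaging argument, with the logarithmic mean of the Möbius function as kernel and the
majorant of `f * 1` as coefficients. -/
lemma tendsto_sum_div_of_tendsto {f : ℕ → ℂ} (hf : IsCM f) (h1 : f 1 = 1)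
    (hb : ∀ p : ℕ, p.Prime → ‖f p‖ ≤ 1)
    (H : Tendsto (fun a => a * Real.exp (primeWeightSum (fun p => ‖1 + f p‖) a))
      (𝓝[>] 0) (𝓝 0)) :
    Tendsto (fun N : ℕ => ∑ n ∈ Icc 1 N, f n / n) atTop (𝓝 0) := by
  have hw : ∀ p : ℕ, p.Prime → 0 ≤ ‖1 + f p‖ := fun p _ => norm_nonneg _
  have hw2 : ∀ p : ℕ, p.Prime → ‖1 + f p‖ ≤ 2 := fun p hp => by
    have := norm_add_le 1 (f p)
    rw [norm_one] at this
    linarith [hb p hp]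
  have hG := prodPrimeFactors_nonneg hw
  set c : ArithmeticFunction ℝ := squareIndicator * prodPrimeFactors fun p => ‖1 + f p‖ with hc
  have hc0 : ∀ n, 0 ≤ c n := fun n => by
    rw [hc, mul_apply]
    exact sum_nonneg fun x _ => mul_nonneg (squareIndicator_nonneg _) (hG _)
  have hE : Tendsto (dyadicSum c) atTop (𝓝 0) :=
    tendsto_dyadicSum_mul squareIndicator_nonneg hG summable_squareIndicator_div
      (tendsto_dyadicSum_prodPrimeFactors hw hw2 H)
  have hmain := tendsto_setIntegral_norm (s := fun w => ∑ n ∈ Ioc 0 ⌊Real.exp w⌋₊, f n / n) hc0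
    integrable_moebiusMean_exp hE (fun w => by
      rw [sum_div_eq_sum_mul_moebiusMean]
      refine norm_sum_le_of_le _ fun d _ => ?_
      rw [norm_mul, norm_div, Complex.norm_natCast]
      gcongr
      exact norm_positivePart_mul_zeta_le hf h1 hb d)
  refine tendsto_sum_of_tendsto_setIntegral (a := fun n => f n / n) (fun n => ?_) hmain
  rcases eq_or_ne n 0 with rfl | hn
  · simp
  · rw [norm_div, Complex.norm_natCast, div_eq_mul_inv]
    exact mul_le_of_le_one_left (by positivity) (hf.norm_le_one h1 hb hn)

/-- Otherwise `f` vanishes identically, the weights are all `1`, and `a * exp (∑ p^(-1-a))` is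
bounded below by a constant multiple of `a ζ(1 + a) → 1`. -/
lemma apply_one_eq_one_of_tendsto {f : ℕ → ℂ} (hf : IsCM f)
    (H : Tendsto (fun a => a * Real.exp (primeWeightSum (fun p => ‖1 + f p‖) a))
      (𝓝[>] 0) (𝓝 0)) : f 1 = 1 := by
  by_contra h1
  have h0 : f 1 = 0 := by
    have := hf 1 1 le_rfl le_rfl
    rw [mul_one] at this
    have h2 : f 1 * (f 1 - 1) = 0 := by rw [mul_sub, ← this, mul_one, sub_self]
    exact (mul_eq_zero.mp h2).resolve_right (sub_ne_zero.mpr h1)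
  have hz : ∀ p : Nat.Primes, f p = 0 := fun p => by
    have := hf p 1 p.2.one_lt.le le_rfl
    rwa [mul_one, h0, mul_zero] at this
  have hw : ∀ a, primeWeightSum (fun p => ‖1 + f p‖) a =
      ∑' p : Nat.Primes, ((p : ℕ) : ℝ) ^ (-(1 + a)) := by
    intro a
    refine tsum_congr fun p => ?_
    have e : ‖1 + f (p : ℕ)‖ = 1 := by simp [hz p]
    change ‖1 + f (p : ℕ)‖ ^ 2 / ((p : ℕ) : ℝ) ^ (1 + a) = _
    rw [e, one_pow, Real.rpow_neg (Nat.cast_nonneg _), one_div]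
  simp_rw [hw] at H
  have hres : Tendsto (fun a : ℝ => ‖(a : ℂ) * riemannZeta (1 + a)‖) (𝓝[>] 0) (𝓝 1) := by
    have hmap : Tendsto (fun a : ℝ => (1 + a : ℂ)) (𝓝[>] 0) (𝓝[≠] 1) := by
      refine tendsto_nhdsWithin_iff.mpr ⟨?_, ?_⟩
      · have : Continuous fun a : ℝ => (1 + a : ℂ) := by fun_prop
        simpa using! (this.tendsto 0).mono_left nhdsWithin_le_nhds
      · filter_upwards [self_mem_nhdsWithin] with a ha
        simpa using (ne_of_gt ha : a ≠ 0)
    have := (riemannZeta_residue_one.comp hmap).norm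
    simpa using! this
  have hle : ∀ᶠ a : ℝ in 𝓝[>] 0, ‖(a : ℂ) * riemannZeta (1 + a)‖ ≤ Real.exp primeSquareSum *
      (a * Real.exp (∑' p : Nat.Primes, ((p : ℕ) : ℝ) ^ (-(1 + a)))) := by
    filter_upwards [self_mem_nhdsWithin] with a ha
    have ha : 0 < a := ha
    rw [norm_mul, Complex.norm_real, Real.norm_of_nonneg ha.le]
    calc _ ≤ a * (Real.exp primeSquareSum *
          Real.exp (∑' p : Nat.Primes, ((p : ℕ) : ℝ) ^ (-(1 + a)))) := by
          gcongr
          exact norm_zeta_le_exp_tsum_primes ha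
      _ = _ := by ring
  have := le_of_tendsto_of_tendsto hres (H.const_mul _) hle
  norm_num at this

/-- The criterion through which both growth conditions act. -/
lemma isCMO_of_tendsto {f : ℕ → ℂ} (hf : IsCM f) (hb : ∀ p : ℕ, p.Prime → ‖f p‖ ≤ 1)
    (H : Tendsto (fun a => a * Real.exp (primeWeightSum (fun p => ‖1 + f p‖) a))
      (𝓝[>] 0) (𝓝 0)) : IsCMO fun n : ℕ => f n / (n : ℂ) := by
  have h1 := apply_one_eq_one_of_tendsto hf H
  refine ⟨⟨1, le_rfl, by simp [h1]⟩, fun a b ha hb' => ?_, tendsto_sum_div_of_tendsto hf h1 hb H⟩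
  rw [hf a b ha hb', Nat.cast_mul, mul_div_mul_comm]

end

/-! ### The growth conditions on the prime values -/

section

open Finset Filter Topology MeasureTheory

lemma primeWeightSum_anti {w : ℕ → ℝ} (hw : ∀ p : ℕ, p.Prime → 0 ≤ w p)
    (hw2 : ∀ p : ℕ, p.Prime → w p ≤ 2) {a b : ℝ} (ha : 0 < a) (hab : a ≤ b) :
    primeWeightSum w b ≤ primeWeightSum w a := by
  refine Summable.tsum_le_tsum (fun p => ?_) (summable_primeWeight hw hw2 (ha.trans_le hab))
    (summable_primeWeight hw hw2 ha)
  have hp : (1 : ℝ) ≤ (p : ℕ) := by exact_mod_cast p.2.one_lt.le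
  gcongr

/-- The integral over `(1, 1 + a]` tends to `0`, and it is at least `√a * exp (D a / 2)` because the
weighted prime sum `D` is antitone and `1 / √(σ - 1) ≥ 1 / √a` there. -/
lemma tendsto_mul_exp_of_setLIntegral_lt_top {w : ℕ → ℝ} (hw : ∀ p : ℕ, p.Prime → 0 ≤ w p)
    (hw2 : ∀ p : ℕ, p.Prime → w p ≤ 2)
    (h : ∫⁻ σ in Set.Ioc (1 : ℝ) 2,
        ENNReal.ofReal
          (Real.exp ((1 / 2) * ∑' p : Nat.Primes, w p ^ 2 / ((p : ℕ) : ℝ) ^ σ)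
            / Real.sqrt (σ - 1)) < ⊤) :
    Tendsto (fun a => a * Real.exp (primeWeightSum w a)) (𝓝[>] 0) (𝓝 0) := by
  have hvol : Tendsto (volume.restrict (Set.Ioc (1 : ℝ) 2) ∘ fun a : ℝ => Set.Ioc 1 (1 + a))
      (𝓝[>] 0) (𝓝 0) := by
    have h0 : Tendsto (fun a : ℝ => ENNReal.ofReal a) (𝓝[>] 0) (𝓝 0) := by
      simpa using (ENNReal.continuous_ofReal.tendsto 0).mono_left nhdsWithin_le_nhds
    refine tendsto_of_tendsto_of_tendsto_of_le_of_le tendsto_const_nhds h0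
      (fun _ => zero_le) fun a => ?_
    refine (Measure.restrict_apply_le _ _).trans ?_
    simp
  have hlim := tendsto_setLIntegral_zero h.ne hvol
  have hle : ∀ᶠ a : ℝ in 𝓝[>] 0,
      ENNReal.ofReal (Real.sqrt a * Real.exp ((1 / 2) * primeWeightSum w a)) ≤
      ∫⁻ σ in Set.Ioc (1 : ℝ) (1 + a), ENNReal.ofReal
          (Real.exp ((1 / 2) * ∑' p : Nat.Primes, w p ^ 2 / ((p : ℕ) : ℝ) ^ σ)
            / Real.sqrt (σ - 1)) ∂(volume.restrict (Set.Ioc (1 : ℝ) 2)) := by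
    filter_upwards [Ioc_mem_nhdsGT (zero_lt_one' ℝ)] with a ha
    obtain ⟨ha, ha1⟩ := ha
    rw [Measure.restrict_restrict measurableSet_Ioc,
      Set.inter_eq_left.mpr (Set.Ioc_subset_Ioc_right (by linarith))]
    calc _ = ∫⁻ _ in Set.Ioc (1 : ℝ) (1 + a),
          ENNReal.ofReal (Real.exp ((1 / 2) * primeWeightSum w a) / Real.sqrt a) := by
          rw [setLIntegral_const, Real.volume_Ioc, ← ENNReal.ofReal_mul (by positivity)]
          congr 1
          have := Real.mul_self_sqrt ha.le
          have h3 : 0 < Real.sqrt a := Real.sqrt_pos.mpr ha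
          rw [add_sub_cancel_left]
          field_simp
          nlinarith
      _ ≤ _ := by
          refine setLIntegral_mono' measurableSet_Ioc fun σ hσ => ENNReal.ofReal_le_ofReal ?_
          have hσ0 : 0 < σ - 1 := by linarith [hσ.1]
          have h3 : 0 < Real.sqrt (σ - 1) := Real.sqrt_pos.mpr hσ0
          have h4 := primeWeightSum_anti hw hw2 hσ0 (by linarith [hσ.2] : σ - 1 ≤ a)
          simp only [primeWeightSum, add_sub_cancel] at h4 ⊢
          gcongr
          linarith [hσ.2]
  have hz := tendsto_of_tendsto_of_tendsto_of_le_of_le' tendsto_const_nhds hlim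
    (Eventually.of_forall fun _ => zero_le) hle
  have hr := ((ENNReal.tendsto_toReal ENNReal.zero_ne_top).comp hz).pow 2
  simp only [ENNReal.toReal_zero, ne_eq, OfNat.ofNat_ne_zero, not_false_eq_true, zero_pow] at hr
  refine hr.congr' ?_
  filter_upwards [self_mem_nhdsWithin] with a ha
  have ha : 0 < a := ha
  rw [Function.comp_apply, ENNReal.toReal_ofReal (by positivity), mul_pow, Real.sq_sqrt ha.le,
    ← Real.exp_nat_mul]
  congr 2
  push_cast
  ring

lemma sum_Icc_prime_le {w : ℕ → ℝ} (hw : ∀ p : ℕ, p.Prime → 0 ≤ w p)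
    (hw2 : ∀ p : ℕ, p.Prime → w p ≤ 2) (n : ℕ) :
    ∑ p ∈ Icc 1 n with p.Prime, w p ^ 2 ≤ 4 * n := by
  rw [sum_filter]
  calc _ ≤ ∑ _p ∈ Icc 1 n, (4 : ℝ) := sum_le_sum fun p _ => by
        split_ifs with hp
        · nlinarith [hw p hp, hw2 p hp]
        · norm_num
    _ = _ := by simp [mul_comm]

lemma primeWeightSum_eq_LSeries (w : ℕ → ℝ) (a : ℝ) :
    (primeWeightSum w a : ℂ) =
      LSeries (fun n => ((if n.Prime then w n ^ 2 else 0 : ℝ) : ℂ)) ((1 + a : ℝ) : ℂ) := by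
  have e : ∀ n : ℕ,
      LSeries.term (fun n => ((if n.Prime then w n ^ 2 else 0 : ℝ) : ℂ)) ((1 + a : ℝ) : ℂ) n =
      Set.indicator {p : ℕ | p.Prime} (fun p => ((w p ^ 2 / (p : ℝ) ^ (1 + a) : ℝ) : ℂ)) n := by
    intro n
    by_cases hn : n.Prime
    · rw [Set.indicator_of_mem (by exact hn), LSeries.term_of_ne_zero hn.ne_zero, if_pos hn,
        Complex.ofReal_div, Complex.ofReal_cpow (Nat.cast_nonneg n), Complex.ofReal_natCast]
    · rw [Set.indicator_of_notMem (by exact hn)]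
      rcases eq_or_ne n 0 with rfl | h0
      · simp
      · rw [LSeries.term_of_ne_zero h0, if_neg hn]
        simp
  rw [LSeries, tsum_congr e, primeWeightSum, Complex.ofReal_tsum]
  exact tsum_subtype {p : ℕ | p.Prime} fun p => ((w p ^ 2 / (p : ℝ) ^ (1 + a) : ℝ) : ℂ)

/-- Partial summation of the weighted prime sum, with a majorant `g` of the integrand. -/
lemma primeWeightSum_le_integral {w : ℕ → ℝ} (hw : ∀ p : ℕ, p.Prime → 0 ≤ w p)
    (hw2 : ∀ p : ℕ, p.Prime → w p ≤ 2) {a : ℝ} (ha : 0 < a) {g : ℝ → ℝ} (hg : Integrable g)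
    (hg0 : ∀ t, 0 ≤ g t) (hle : ∀ t, 1 < t →
      (∑ p ∈ Icc 1 ⌊t⌋₊ with p.Prime, w p ^ 2) * t ^ (-(2 + a)) ≤ g t) :
    primeWeightSum w a ≤ (1 + a) * ∫ t, g t := by
  have hnn : ∀ n, (0 : ℝ) ≤ if n.Prime then w n ^ 2 else 0 := fun n => by positivity
  have hO : (fun n : ℕ => ∑ k ∈ Icc 1 n, if k.Prime then w k ^ 2 else 0) =O[atTop]
      fun n => (n : ℝ) ^ (1 : ℝ) := by
    refine Asymptotics.IsBigO.of_bound 4 (Eventually.of_forall fun n => ?_)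
    rw [Real.rpow_one, Real.norm_of_nonneg (sum_nonneg fun k _ => hnn k), Real.norm_natCast,
      ← sum_filter]
    exact sum_Icc_prime_le hw hw2 n
  have h := LSeries_eq_mul_integral_of_nonneg _ zero_le_one (s := ((1 + a : ℝ) : ℂ))
    (by simpa using! ha) hO hnn
  rw [← primeWeightSum_eq_LSeries, ← integral_indicator measurableSet_Ioi] at h
  have h0 : 0 ≤ primeWeightSum w a := tsum_nonneg fun p => by positivity
  rw [← Real.norm_of_nonneg h0, ← Complex.norm_real, h, norm_mul, Complex.norm_real,
    Real.norm_of_nonneg (by linarith : 0 ≤ 1 + a)]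
  refine mul_le_mul_of_nonneg_left ?_ (by linarith)
  refine norm_integral_le_of_norm_le hg (ae_of_all _ fun t => ?_)
  by_cases ht : t ∈ Set.Ioi (1 : ℝ)
  · have ht1 : 1 < t := ht
    rw [Set.indicator_of_mem ht, norm_mul, Complex.norm_cpow_eq_rpow_re_of_pos (by linarith),
      ← Complex.ofReal_sum, Complex.norm_real, Real.norm_of_nonneg (sum_nonneg fun k _ => hnn k),
      ← sum_filter]
    convert! hle t ht1 using 2
    congr 1
    simp
    ring
  · rw [Set.indicator_of_notMem ht, norm_zero]
    exact hg0 t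

lemma integral_one_div_mul_log {x y : ℝ} (hx : 1 < x) (hxy : x ≤ y) :
    IntegrableOn (fun t => 1 / (t * Real.log t)) (Set.Ioc x y) ∧
    ∫ t in Set.Ioc x y, 1 / (t * Real.log t) =
      Real.log (Real.log y) - Real.log (Real.log x) := by
  have hpos : ∀ t ∈ Set.uIcc x y, 0 < t ∧ 0 < Real.log t := fun t ht => by
    rw [Set.uIcc_of_le hxy] at ht
    have : 1 < t := hx.trans_le ht.1
    exact ⟨by linarith, Real.log_pos this⟩
  have hc : IntervalIntegrable (fun t => 1 / (t * Real.log t)) volume x y := by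
    refine ContinuousOn.intervalIntegrable fun t ht => ?_
    obtain ⟨h1, h2⟩ := hpos t ht
    have := h1.ne'
    have := (mul_pos h1 h2).ne'
    exact ContinuousAt.continuousWithinAt (by fun_prop (disch := assumption))
  refine ⟨(intervalIntegrable_iff_integrableOn_Ioc_of_le hxy).mp hc, ?_⟩
  rw [← intervalIntegral.integral_of_le hxy]
  refine intervalIntegral.integral_eq_sub_of_hasDerivAt (f := fun t => Real.log (Real.log t))
    (fun t ht => ?_) hc
  obtain ⟨h1, h2⟩ := hpos t ht
  convert! (Real.hasDerivAt_log h1.ne').log h2.ne' using 1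
  field_simp

/-- In the partial summation integral, the trivial bound is used up to `x`; the hypothesis gives
`δ / (t log t)` between `x` and `e^(1/a)`, whose integral is a difference of values of `log log`;
beyond, `1 / log t ≤ a` and the decay of `t^(-1-a)` give a bounded contribution. -/
lemma primeWeightSum_le_of_sum_le {w : ℕ → ℝ} (hw : ∀ p : ℕ, p.Prime → 0 ≤ w p)
    (hw2 : ∀ p : ℕ, p.Prime → w p ≤ 2) {δ x a : ℝ} (hδ : 0 ≤ δ) (hx : 3 ≤ x)
    (h : ∀ t, x ≤ t → ∑ p ∈ Icc 1 ⌊t⌋₊ with p.Prime, w p ^ 2 ≤ δ * (t / Real.log t))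
    (ha : 0 < a) (hxa : x ≤ Real.exp a⁻¹) :
    primeWeightSum w a ≤ (1 + a) * (4 * Real.log x + δ * Real.log a⁻¹ + δ) := by
  set X := Real.exp a⁻¹ with hX
  have hlogx : 1 ≤ Real.log x := by
    rw [Real.le_log_iff_exp_le (by linarith)]
    linarith [Real.exp_one_lt_d9]
  obtain ⟨hi2, he2⟩ := integral_one_div_mul_log (by linarith : 1 < x) hxa
  have hi1 : IntegrableOn (fun t : ℝ => t⁻¹) (Set.Ioc 1 x) := by
    rw [← intervalIntegrable_iff_integrableOn_Ioc_of_le (by linarith)]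
    rw [intervalIntegrable_inv_iff]
    right
    rw [Set.uIcc_of_le (by linarith)]
    exact fun h0 => by linarith [h0.1]
  have he1 : ∫ t in Set.Ioc 1 x, t⁻¹ = Real.log x := by
    rw [← intervalIntegral.integral_of_le (by linarith), integral_inv_of_pos one_pos (by linarith),
      div_one]
  have hX0 : 0 < X := Real.exp_pos _
  have hi3 : IntegrableOn (fun t : ℝ => t ^ (-1 - a)) (Set.Ioi X) :=
    integrableOn_Ioi_rpow_of_lt (by linarith) hX0
  have he3 : ∫ t in Set.Ioi X, t ^ (-1 - a) ≤ a⁻¹ := by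
    rw [integral_Ioi_rpow_of_lt (by linarith) hX0]
    have h1 : X ^ (-1 - a + 1) ≤ 1 :=
      Real.rpow_le_one_of_one_le_of_nonpos (by linarith) (by linarith)
    rw [show -1 - a + 1 = -a by ring] at h1 ⊢
    rw [neg_div_neg_eq, div_eq_mul_inv]
    exact mul_le_of_le_one_left (by positivity) h1
  have hi1' := (integrable_indicator_iff measurableSet_Ioc).mpr (hi1.const_mul 4)
  have hi2' := (integrable_indicator_iff measurableSet_Ioc).mpr (hi2.const_mul δ)
  have hi3' := (integrable_indicator_iff measurableSet_Ioi).mpr (hi3.const_mul (δ * a))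
  have hmain := primeWeightSum_le_integral hw hw2 ha ((hi1'.add hi2').add hi3') (fun t => ?_)
    (fun t ht => ?_)
  · refine hmain.trans (mul_le_mul_of_nonneg_left ?_ (by linarith))
    rw [integral_add' (hi1'.add hi2') hi3', integral_add' hi1' hi2',
      integral_indicator measurableSet_Ioc, integral_indicator measurableSet_Ioc,
      integral_indicator measurableSet_Ioi, integral_const_mul, integral_const_mul,
      integral_const_mul, he1, he2, hX, Real.log_exp, ← hX]
    have h1 : δ * a * ∫ t in Set.Ioi X, t ^ (-1 - a) ≤ δ * a * a⁻¹ := by gcongr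
    rw [mul_assoc δ a a⁻¹, mul_inv_cancel₀ ha.ne', mul_one] at h1
    have h2 : 0 ≤ δ * Real.log (Real.log x) := mul_nonneg hδ (Real.log_nonneg hlogx)
    linarith
  · refine add_nonneg (add_nonneg ?_ ?_) ?_ <;>
      refine Set.indicator_nonneg (fun t ht => ?_) t
    · have : 0 < t := by linarith [ht.1]
      positivity
    · have h0 : 1 < t := by linarith [ht.1]
      have := Real.log_pos h0
      positivity
    · have : 0 < t := hX0.trans ht
      positivity
  · have ht0 : 0 < t := by linarith
    have hlt := Real.log_pos ht
    have hA : t * t ^ (-(2 + a)) = t ^ (-1 - a) := by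
      rw [← Real.rpow_one_add' ht0.le (by linarith)]
      ring_nf
    have hB : t ^ (-1 - a) ≤ t⁻¹ := by
      rw [← Real.rpow_neg_one]
      exact Real.rpow_le_rpow_of_exponent_le ht.le (by linarith)
    have hp : 0 ≤ t ^ (-(2 + a)) := by positivity
    simp only [Pi.add_apply]
    rcases le_or_gt t x with h1 | h1
    · rw [Set.indicator_of_mem (show t ∈ Set.Ioc 1 x from ⟨ht, h1⟩),
        Set.indicator_of_notMem (fun hh => by linarith [hh.1]),
        Set.indicator_of_notMem (fun hh => by linarith [Set.mem_Ioi.mp hh]), add_zero, add_zero]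
      calc _ ≤ 4 * t * t ^ (-(2 + a)) := by
            refine mul_le_mul_of_nonneg_right ((sum_Icc_prime_le hw hw2 _).trans ?_) hp
            have := Nat.floor_le ht0.le
            linarith
        _ ≤ _ := by rw [mul_assoc, hA]; linarith
    · have hs := mul_le_mul_of_nonneg_right (h t h1.le) hp
      have e : δ * (t / Real.log t) * t ^ (-(2 + a)) = δ * (t ^ (-1 - a) / Real.log t) := by
        rw [← hA]; ring
      rw [e] at hs
      rcases le_or_gt t X with h2 | h2
      · rw [Set.indicator_of_notMem (fun hh => by linarith [hh.2]),
          Set.indicator_of_mem (show t ∈ Set.Ioc x X from ⟨h1, h2⟩),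
          Set.indicator_of_notMem (fun hh => by linarith [Set.mem_Ioi.mp hh]), add_zero, zero_add]
        refine hs.trans (mul_le_mul_of_nonneg_left ?_ hδ)
        rw [one_div, mul_inv, ← div_eq_mul_inv]
        gcongr
      · rw [Set.indicator_of_notMem (fun hh => by linarith [hh.2]),
          Set.indicator_of_notMem (fun hh => by linarith [hh.2]),
          Set.indicator_of_mem (show t ∈ Set.Ioi X from h2), zero_add, zero_add, mul_assoc]
        refine hs.trans (mul_le_mul_of_nonneg_left ?_ hδ)
        have h3 : a⁻¹ ≤ Real.log t := by
          rw [Real.le_log_iff_exp_le ht0]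
          exact h2.le
        rw [div_eq_mul_inv, mul_comm]
        refine mul_le_mul_of_nonneg_right ?_ (by positivity)
        exact inv_le_of_inv_le₀ ha h3

lemma tendsto_mul_exp_of_limsup_lt_one {w : ℕ → ℝ} (hw : ∀ p : ℕ, p.Prime → 0 ≤ w p)
    (hw2 : ∀ p : ℕ, p.Prime → w p ≤ 2)
    (h : Filter.limsup
        (fun x : ℝ =>
          (((∑ p ∈ Icc 1 ⌊x⌋₊ with p.Prime, w p ^ 2) / (x / Real.log x) : ℝ) : EReal))
        atTop < 1) :
    Tendsto (fun a => a * Real.exp (primeWeightSum w a)) (𝓝[>] 0) (𝓝 0) := by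
  obtain ⟨δ, hδ, hδ1, hev⟩ : ∃ δ : ℝ, 0 ≤ δ ∧ δ < 1 ∧ ∀ᶠ x : ℝ in atTop,
      (∑ p ∈ Icc 1 ⌊x⌋₊ with p.Prime, w p ^ 2) / (x / Real.log x) ≤ δ := by
    obtain ⟨δ, h1, h2⟩ := EReal.lt_iff_exists_real_btwn.mp h
    -- `max` with `0`, as a bound for the `limsup` carries no sign by itself
    refine ⟨max δ 0, le_max_right _ _, max_lt (by exact_mod_cast h2) one_pos, ?_⟩
    filter_upwards [eventually_lt_of_limsup_lt h1] with x hx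
    exact (EReal.coe_lt_coe_iff.mp hx).le.trans (le_max_left _ _)
  obtain ⟨x, hx3, hx⟩ := ((eventually_ge_atTop (3 : ℝ)).and (eventually_forall_ge_atTop.mpr
    hev)).exists
  have hsum : ∀ t, x ≤ t → ∑ p ∈ Icc 1 ⌊t⌋₊ with p.Prime, w p ^ 2 ≤ δ * (t / Real.log t) := by
    intro t ht
    have h0 : 0 < t / Real.log t := div_pos (by linarith) (Real.log_pos (by linarith))
    exact (div_le_iff₀ h0).mp (hx t ht)
  set C := 8 * Real.log x + 3 with hC
  have hlogx : 0 ≤ Real.log x := Real.log_nonneg (by linarith)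
  have hlim : Tendsto (fun a : ℝ => Real.exp C * a ^ (1 - δ)) (𝓝[>] 0) (𝓝 0) := by
    have h0 : ContinuousAt (fun a : ℝ => a ^ (1 - δ)) 0 :=
      Real.continuousAt_rpow_const _ _ (Or.inr (by linarith))
    have h1 := (h0.tendsto.mono_left (nhdsWithin_le_nhds (s := Set.Ioi 0))).const_mul (Real.exp C)
    rwa [Real.zero_rpow (by linarith), mul_zero] at h1
  have hexp : ∀ᶠ a : ℝ in 𝓝[>] 0, x ≤ Real.exp a⁻¹ :=
    (Real.tendsto_exp_atTop.comp tendsto_inv_nhdsGT_zero).eventually_ge_atTop x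
  refine tendsto_of_tendsto_of_tendsto_of_le_of_le' tendsto_const_nhds hlim ?_ ?_
  · filter_upwards [self_mem_nhdsWithin] with a ha
    have ha : 0 < a := ha
    positivity
  · filter_upwards [Ioc_mem_nhdsGT (zero_lt_one' ℝ), hexp] with a ha hxa
    obtain ⟨ha, ha1⟩ := ha
    have hD := primeWeightSum_le_of_sum_le hw hw2 hδ hx3 hsum ha hxa
    have hlog : Real.log a⁻¹ ≤ a⁻¹ := (Real.log_le_sub_one_of_pos (by positivity)).trans
      (by linarith)
    have h1 : a * Real.log a⁻¹ ≤ 1 := by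
      calc _ ≤ a * a⁻¹ := by gcongr
        _ = 1 := mul_inv_cancel₀ ha.ne'
    have h2 : primeWeightSum w a ≤ C + δ * Real.log a⁻¹ := by
      refine hD.trans ?_
      have h3 : δ * (a * Real.log a⁻¹) ≤ 1 := by nlinarith
      have h4 : a * Real.log x ≤ Real.log x := mul_le_of_le_one_left hlogx ha1
      have h5 : a * δ ≤ 1 := by nlinarith
      rw [hC]
      nlinarith
    calc a * Real.exp (primeWeightSum w a) ≤ a * Real.exp (C + δ * Real.log a⁻¹) := by gcongr
      _ = Real.exp C * a ^ (1 - δ) := by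
        rw [Real.exp_add, Real.rpow_sub ha, Real.rpow_one, Real.log_inv, Real.rpow_def_of_pos ha,
          mul_neg, Real.exp_neg, mul_comm (Real.log a)]
        field_simp

end

theorem mainTheorem3 (f : ℕ → ℂ) (hf : IsCM f)
    (hb : ∀ p : ℕ, p.Prime → ‖f p‖ ≤ 1) :
    (Filter.limsup
        (fun x : ℝ =>
          (((∑ p ∈ Finset.Icc 1 ⌊x⌋₊ with p.Prime, ‖1 + f p‖ ^ 2) / (x / Real.log x) : ℝ) : EReal))
        Filter.atTop < 1 →
      IsCMO (fun n : ℕ => f n / (n : ℂ))) ∧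
    (∫⁻ σ in Set.Ioc (1 : ℝ) 2,
        ENNReal.ofReal
          (Real.exp ((1 / 2) * ∑' p : Nat.Primes, ‖1 + f (p : ℕ)‖ ^ 2 / ((p : ℕ) : ℝ) ^ σ)
            / Real.sqrt (σ - 1)) < ⊤ →
      IsCMO (fun n : ℕ => f n / (n : ℂ))) := by
  have hw : ∀ p : ℕ, p.Prime → 0 ≤ ‖1 + f p‖ := fun p _ => norm_nonneg _
  have hw2 : ∀ p : ℕ, p.Prime → ‖1 + f p‖ ≤ 2 := fun p hp => by
    have := norm_add_le 1 (f p)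
    rw [norm_one] at this
    linarith [hb p hp]
  exact ⟨fun h => isCMO_of_tendsto hf hb (tendsto_mul_exp_of_limsup_lt_one hw hw2 h),
    fun h => isCMO_of_tendsto hf hb (tendsto_mul_exp_of_setLIntegral_lt_top hw hw2 h)⟩
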